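/- Notation. For $f:\mathbb R\to\mathbb C$ and $\lambda,k,n\in\mathbb R$ put $f_{\lambda;k,n}(x)=|\lambda|^{1/2}e^{-in\lambda x}f(\lambda x-k)$ and $f_{\lambda;k}=f_{\lambda;k,0}$; for $\lambda\neq 0$ this is extended by duality to distributions. $\mathscr D$ is the space of compactly supported $C^\infty$ functions $\mathbb R\to\mathbb C$, $\mathscr D'$ its dual, $\langle f,g\rangle=\int f\bar g$ for functions, and $\langle u,f\rangle=u(\bar f)$, $\langle f,u\rangle=\overline{u(\bar f)}$ for $f\in\mathscr D$, $u\in\mathscr D'$. The Fourier transform is $\hat f(\xi)=\int f(x)e^{-ix\xi}\,dx$, extended to $L_2(\mathbb R)$. Let $d$ be a real number with $|d|>1$, and let $\Phi=\{\varphi^1,\dots,\varphi^r\}$ and $\Psi=\{\psi^1,\dots,\psi^s\}$ be finite families of distributions in $\mathscr D'(\mathbb R)$ (repetitions allowed). The following statements are equivalent. (1) For some integer $J$: $\Phi,\Psi\subseteq L_2(\mathbb R)$ and $$\sum_{\ell=1}^r\sum_{k\in\mathbb Z}|\langle f,\varphi^\ell_{d^{-J};0,k}\rangle|^2+\sum_{j=J}^\infty\sum_{\ell=1}^s\sum_{k\in\mathbb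 Z}|\langle f,\psi^\ell_{d^{-j};0,k}\rangle|^2=2\pi\|f\|_{L_2}^2\qquad\text{for all } f\in L_2(\mathbb R).$$ (2) The assertion in (1) holds for all integers $J$. (3) For some integer $J$ (equivalently, for all integers $J$): for all $f,g\in\mathscr D$ the series $\sum_{k\in\mathbb Z}\langle f,\varphi^\ell_{d^{-J};0,k}\rangle\langle\varphi^\ell_{d^{-J};0,k},g\rangle$ $(1\le\ell\le r)$ and $\sum_{k\in\mathbb Z}\langle f,\psi^\ell_{d^{-j};0,k}\rangle\langle\psi^\ell_{d^{-j};0,k},g\rangle$ $(j\ge J,\ 1\le\ell\le s)$ converge absolutely, and $$\lim_{J'\to+\infty}\Big(\sum_{\ell=1}^r\sum_{k\in\mathbb Z}\langle f,\varphi^\ell_{d^{-J};0,k}\rangle\langle\varphi^\ell_{d^{-J};0,k},g\rangle+\sum_{j=J}^{J'-1}\sum_{\ell=1}^s\sum_{k\in\mathbb Z}\langle f,\psi^\ell_{d^{-j};0,k}\rangle\langle\psi^\ell_{d^{-j};0,k},g\rangle\Big)=2\pi\langle f,g\rangle .$$ (4) $\varphi^1,\dots,\varphi^r,\psi^1,\dots,\psi^s$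 are locally square integrable functions such that $$\lim_{j\to+\infty}\sum_{\ell=1}^r|\varphi^\ell(d^{-j}\,\cdot)|^2=1\quad\text{in the sense of distributions,}$$ $$\sum_{\ell=1}^r\overline{\varphi^\ell(\xi)}\varphi^\ell(\xi+2\pi k)+\sum_{\ell=1}^s\overline{\psi^\ell(\xi)}\psi^\ell(\xi+2\pi k)=\sum_{\ell=1}^r\overline{\varphi^\ell(d^{-1}\xi)}\varphi^\ell(d^{-1}(\xi+2\pi k))\quad\text{for a.e. }\xi,\ \text{for all } k\in\mathbb Z\cap d\mathbb Z,$$ $$\sum_{\ell=1}^r\overline{\varphi^\ell(\xi)}\varphi^\ell(\xi+2\pi k)+\sum_{\ell=1}^s\overline{\psi^\ell(\xi)}\psi^\ell(\xi+2\pi k)=0\quad\text{for a.e. }\xi,\ \text{for all } k\in\mathbb Z\setminus d\mathbb Z,$$ $$\sum_{\ell=1}^r\overline{\varphi^\ell(\xi)}\varphi^\ell(\xi+2\pi d^{-1}k)=0\quad\text{for a.e. }\xi,\ \text{for all } k\in d\mathbb Z\setminus\mathbb Z.$$ (5) For some integer $J$ (equivalently, for all integers $J$) there exist $\phi^1,\dots,\phi^r,\eta^1,\dots,\eta^s\in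 L_2(\mathbb R)$ with $\varphi^\ell=\widehat{\phi^\ell}$ $(1\le\ell\le r)$, $\psi^\ell=\widehat{\eta^\ell}$ $(1\le\ell\le s)$ and $$\sum_{\ell=1}^r\sum_{k\in\mathbb Z}|\langle f,\phi^\ell_{d^J;k}\rangle|^2+\sum_{j=J}^\infty\sum_{\ell=1}^s\sum_{k\in\mathbb Z}|\langle f,\eta^\ell_{d^j;k}\rangle|^2=\|f\|_{L_2}^2\qquad\text{for all } f\in L_2(\mathbb R).$$ Moreover, any of these statements implies that $\Psi\subseteq L_2(\mathbb R)$ and $$\sum_{j\in\mathbb Z}\sum_{\ell=1}^s\sum_{k\in\mathbb Z}|\langle f,\psi^\ell_{d^j;0,k}\rangle|^2=2\pi\|f\|_{L_2}^2\qquad\text{for all } f\in L_2(\mathbb R).$$ -/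

import Mathlib

open MeasureTheory TopologicalSpace Filter
open scoped Distributions Topology ENNReal FourierTransform

noncomputable section

namespace WaveletFrames

/-! ### Test functions, distributions and their dilations, translations and modulations -/

/-- The space of compactly supported smooth functions from `ℝ` to `ℂ`, with its LF topology. -/
abbrev TestFn : Type := 𝓓((⊤ : Opens ℝ), ℂ)

/-- The space of complex distributions on `ℝ`: continuous complex linear functionals on the space
of complex test functions. -/
abbrev Distr : Type := TestFn →L[ℂ] ℂ

/-- The function `x ↦ |lam| ^ (1/2) * exp (-i n lam x) * f (lam x - k)`. -/
def tdm (f : ℝ → ℂ) (lam k n : ℝ) (x : ℝ) : ℂ :=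
  (Real.sqrt |lam| : ℂ) * Complex.exp (-Complex.I * n * lam * x) * f (lam * x - k)

/-- The compact set `{lam * x - k | x ∈ K}`. -/
def affineCompacts (lam k : ℝ) (K : Compacts ℝ) : Compacts ℝ :=
  K.map (fun x => lam * x - k) (by fun_prop)

/-- Pullback `h ↦ (y ↦ h ((y + k) / lam))` of smooth functions supported in a compact set. -/
def affinePullback (lam k : ℝ) (hlam : lam ≠ 0) (K : Compacts ℝ) :
    𝓓_{K}(ℝ, ℂ) →L[ℂ] 𝓓_{affineCompacts lam k K}(ℝ, ℂ) :=
  ContDiffMapSupportedIn.mkCLM ℂ (fun h y => h ((y + k) / lam))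
    (fun _ _ _ => rfl) (fun _ _ _ => rfl)
    (fun h => h.contDiff.comp (by fun_prop))
    (fun h y hy => h.zero_on_compl (fun hK => hy ⟨_, hK, by field_simp; ring⟩))
    (fun i _ => by
      refine ⟨Finset.Iic i, (i.factorial : ℝ) * (|lam|⁻¹ + 1) ^ i, by positivity, fun h y _ => ?_⟩
      have hf : ContDiff ℝ (⊤ : ℕ∞) (fun y : ℝ => (y + k) / lam) := by fun_prop
      have key := norm_iteratedFDeriv_comp_le (𝕜 := ℝ) (n := i)
        (C := ((Finset.Iic i).sup fun j => ContDiffMapSupportedIn.seminorm ℂ ℝ ℂ ⊤ K j) h)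
        (D := |lam|⁻¹ + 1) h.contDiff hf (by exact_mod_cast le_top) y
        (fun j hj => (ContDiffMapSupportedIn.norm_iteratedFDeriv_apply_le_seminorm_top ℂ).trans
          (Seminorm.le_finset_sup_apply (Finset.mem_Iic.2 hj)))
        (fun j hj _ => by
          have h1 : (1 : ℝ) ≤ |lam|⁻¹ + 1 := by
            have : 0 ≤ |lam|⁻¹ := by positivity
            linarith
          have h2 : deriv (fun y : ℝ => (y + k) / lam) = fun _ => lam⁻¹ := by
            ext z; simp [div_eq_mul_inv]
          rw [norm_iteratedFDeriv_eq_norm_iteratedDeriv]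
          obtain ⟨m, rfl⟩ : ∃ m, j = m + 1 := ⟨j - 1, by omega⟩
          rw [iteratedDeriv_succ', h2]
          rcases m with _ | m
          · simp
          · simp only [iteratedDeriv_succ', deriv_const']
            have : iteratedDeriv m (fun _ : ℝ => (0 : ℝ)) y = 0 := by simp
            rw [this]
            simpa using by positivity)
      calc _ ≤ _ := key
        _ = _ := by ring)

/-- The multiplier `y ↦ |lam| ^ (-1/2) * exp (-i n (y + k))`. -/
def dualMultiplier (lam k n : ℝ) (y : ℝ) : ℂ :=
  ((Real.sqrt |lam|)⁻¹ : ℂ) * Complex.exp (-Complex.I * n * (y + k))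

lemma contDiff_dualMultiplier (lam k n : ℝ) :
    ContDiff ℝ (⊤ : ℕ∞) (dualMultiplier lam k n) := by
  unfold dualMultiplier
  exact contDiff_const.mul (Complex.contDiff_exp.comp (contDiff_const.mul
    (Complex.ofRealCLM.contDiff.add contDiff_const)))

lemma hasCompactSupport_dual (lam k n : ℝ) (hlam : lam ≠ 0) (h : TestFn) :
    HasCompactSupport (fun y : ℝ => h ((y + k) / lam) * dualMultiplier lam k n y) := by
  refine HasCompactSupport.mul_right ?_
  refine HasCompactSupport.intro
    (h.hasCompactSupport.isCompact.image (f := fun x => lam * x - k) (by fun_prop)) ?_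
  intro y hy
  refine image_eq_zero_of_notMem_tsupport (fun hK => hy ⟨_, hK, ?_⟩)
  field_simp
  ring

/-- The transpose of the operation `u ↦ tdm u lam k n`: the test function
`y ↦ |lam| ^ (-1/2) * exp (-i n (y + k)) * h ((y + k) / lam)`. -/
def dualTdmFun (lam k n : ℝ) (hlam : lam ≠ 0) (h : TestFn) : TestFn where
  toFun y := h ((y + k) / lam) * dualMultiplier lam k n y
  contDiff' := (h.contDiff.comp (by fun_prop)).mul (contDiff_dualMultiplier lam k n)
  hasCompactSupport' := hasCompactSupport_dual lam k n hlam h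
  tsupport_subset' := fun _ _ => trivial

/-- `dualTdmFun` as a continuous linear operator on test functions. -/
def dualTdm (lam k n : ℝ) (hlam : lam ≠ 0) : TestFn →L[ℂ] TestFn :=
  TestFunction.limitCLM ℂ (dualTdmFun lam k n hlam)
    (fun K _ => (TestFunction.ofSupportedInCLM ℂ (fun _ _ => trivial)) ∘L
      (ContDiffMapSupportedIn.bilinLeftCLM (ContinuousLinearMap.mul ℂ ℂ)
        (contDiff_dualMultiplier lam k n)) ∘L (affinePullback lam k hlam K))
    (fun _ _ _ => rfl)

open scoped Classical in
/-- The distribution `u_{lam; k, n}`, defined by duality from `tdm` (for `lam ≠ 0`). -/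
def Distr.tdm (u : Distr) (lam k n : ℝ) : Distr :=
  if hlam : lam ≠ 0 then u ∘L dualTdm lam k n hlam else 0

/-- Complex conjugation of test functions. -/
def conjTest (f : TestFn) : TestFn :=
  TestFunction.postcompCLM (𝕜 := ℝ) (Complex.conjCLE : ℂ →L[ℝ] ℂ) f

/-- The pairing `⟨u, f⟩ = u (conj f)` of a distribution with a test function. -/
def pairDT (u : Distr) (f : TestFn) : ℂ := u (conjTest f)

/-- The pairing `⟨f, u⟩`, the complex conjugate of `⟨u, f⟩`. -/
def pairTD (f : TestFn) (u : Distr) : ℂ := starRingEnd ℂ (pairDT u f)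

/-- The pairing `⟨f, g⟩ = ∫ f * conj g` of functions. -/
def pairFn (f g : ℝ → ℂ) : ℂ := ∫ x, f x * starRingEnd ℂ (g x)

/-- The distribution `u` is given by the locally integrable function `F`. -/
def IsGivenBy (u : Distr) (F : ℝ → ℂ) : Prop :=
  LocallyIntegrable F volume ∧ ∀ h : TestFn, u h = ∫ x, F x * h x

/-- Local square integrability. -/
def LocL2 (F : ℝ → ℂ) : Prop :=
  AEStronglyMeasurable F volume ∧ ∀ K : Set ℝ, IsCompact K → MemLp F 2 (volume.restrict K)

/-! ### Wavelet systems

Families indexed by `Fin r` and `Fin s` play the role of the finite generating sets, in which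
repetitions are allowed. Sums of nonnegative terms are taken in `[0, ∞]`. A sum over the scales
`j ≥ J` is written as a sum over `j = J + i` with `i` a natural number. -/

/-- The sum of `|⟨f, h⟩|²` over all `h` in the frequency-based nonhomogeneous system generated by
the functions `F` and `G` with coarsest level `J`. -/
def freqEnergy (d : ℝ) (J : ℤ) {r s : ℕ} (F : Fin r → ℝ → ℂ) (G : Fin s → ℝ → ℂ)
    (f : ℝ → ℂ) : ℝ≥0∞ :=
  (∑ l, ∑' k : ℤ, ‖pairFn f (tdm (F l) (d ^ (-J)) 0 k)‖ₑ ^ 2) +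
    ∑' i : ℕ, ∑ l, ∑' k : ℤ, ‖pairFn f (tdm (G l) (d ^ (-(J + (i : ℤ)))) 0 k)‖ₑ ^ 2

/-- The sum of `|⟨f, h⟩|²` over all `h` in the time-domain nonhomogeneous system generated by
the functions `φ` and `ψ` with coarsest level `J`. -/
def timeEnergy (d : ℝ) (J : ℤ) {r s : ℕ} (φ : Fin r → ℝ → ℂ) (ψ : Fin s → ℝ → ℂ)
    (f : ℝ → ℂ) : ℝ≥0∞ :=
  (∑ l, ∑' k : ℤ, ‖pairFn f (tdm (φ l) (d ^ J) k 0)‖ₑ ^ 2) +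
    ∑' i : ℕ, ∑ l, ∑' k : ℤ, ‖pairFn f (tdm (ψ l) (d ^ (J + (i : ℤ))) k 0)‖ₑ ^ 2

/-- The sum of `|⟨f, h⟩|²` over all `h` in the frequency-based homogeneous system generated by
the functions `G`. -/
def freqHomEnergy (d : ℝ) {s : ℕ} (G : Fin s → ℝ → ℂ) (f : ℝ → ℂ) : ℝ≥0∞ :=
  ∑' j : ℤ, ∑ l, ∑' k : ℤ, ‖pairFn f (tdm (G l) (d ^ j) 0 k)‖ₑ ^ 2

/-- The frequency-based nonhomogeneous wavelet system with level `J` generated by `Φ` and `Ψ` is a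
tight frame in `L²(ℝ)`: all the generators are square integrable, and the squared moduli of the
coefficients of every `f ∈ L²(ℝ)` sum to `2π ‖f‖²`. -/
def IsFreqTightFrame (d : ℝ) (J : ℤ) {r s : ℕ} (Φ : Fin r → Distr) (Ψ : Fin s → Distr) : Prop :=
  ∃ (F : Fin r → ℝ → ℂ) (G : Fin s → ℝ → ℂ),
    (∀ l, MemLp (F l) 2 volume ∧ IsGivenBy (Φ l) (F l)) ∧
    (∀ l, MemLp (G l) 2 volume ∧ IsGivenBy (Ψ l) (G l)) ∧
    ∀ f : ℝ → ℂ, MemLp f 2 volume →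
      freqEnergy d J F G f = ENNReal.ofReal (2 * Real.pi) * eLpNorm f 2 volume ^ 2

/-- The frequency-based homogeneous wavelet system generated by `Ψ` is a tight frame in
`L²(ℝ)`. -/
def IsFreqHomTightFrame (d : ℝ) {s : ℕ} (Ψ : Fin s → Distr) : Prop :=
  ∃ G : Fin s → ℝ → ℂ,
    (∀ l, MemLp (G l) 2 volume ∧ IsGivenBy (Ψ l) (G l)) ∧
    ∀ f : ℝ → ℂ, MemLp f 2 volume →
      freqHomEnergy d G f = ENNReal.ofReal (2 * Real.pi) * eLpNorm f 2 volume ^ 2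

/-- The Fourier transform `ξ ↦ ∫ φ(x) exp (-i x ξ) dx` on `L²(ℝ)`, obtained by rescaling from
Mathlib's, whose kernel is `exp (-2π i x ξ)`. -/
def fourierL2 (φ : Lp ℂ 2 (volume : Measure ℝ)) (ξ : ℝ) : ℂ :=
  (𝓕 φ : Lp ℂ 2 (volume : Measure ℝ)) (ξ / (2 * Real.pi))

/-- `Φ` and `Ψ` are the Fourier transforms of square integrable functions that generate a
nonhomogeneous tight wavelet frame with level `J` in `L²(ℝ)`. -/
def IsFourierOfTightFrame (d : ℝ) (J : ℤ) {r s : ℕ} (Φ : Fin r → Distr) (Ψ : Fin s → Distr) :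
    Prop :=
  ∃ (φ : Fin r → Lp ℂ 2 (volume : Measure ℝ)) (ψ : Fin s → Lp ℂ 2 (volume : Measure ℝ)),
    (∀ l, IsGivenBy (Φ l) (fourierL2 (φ l))) ∧
    (∀ l, IsGivenBy (Ψ l) (fourierL2 (ψ l))) ∧
    ∀ f : ℝ → ℂ, MemLp f 2 volume →
      timeEnergy d J (fun l => ⇑(φ l)) (fun l => ⇑(ψ l)) f = eLpNorm f 2 volume ^ 2

/-- A term `⟨f, u_{lam; 0, k}⟩ ⟨u'_{lam; 0, k}, g⟩` of the wavelet expansion. -/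
def dualTerm (lam : ℝ) (u u' : Distr) (f g : TestFn) (k : ℤ) : ℂ :=
  pairTD f (u.tdm lam 0 k) * pairDT (u'.tdm lam 0 k) g

/-- The two systems with level `J` generated by `Φ`, `Ψ` and by `Φ'`, `Ψ'` form a pair of
frequency-based nonhomogeneous dual wavelet frames in the distribution space: all the series over
`k` converge absolutely, and the partial sums over the scales `J ≤ j < J'` tend to `2π ⟨f, g⟩` as
`J' → ∞`. -/
def IsDualFramePair (d : ℝ) (J : ℤ) {r s : ℕ} (Φ : Fin r → Distr) (Ψ : Fin s → Distr)
    (Φ' : Fin r → Distr) (Ψ' : Fin s → Distr) : Prop :=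
  ∀ f g : TestFn,
    (∀ l, Summable fun k : ℤ => ‖dualTerm (d ^ (-J)) (Φ l) (Φ' l) f g k‖) ∧
    (∀ j : ℤ, J ≤ j → ∀ l, Summable fun k : ℤ => ‖dualTerm (d ^ (-j)) (Ψ l) (Ψ' l) f g k‖) ∧
    Tendsto
      (fun J' : ℤ =>
        (∑ l, ∑' k : ℤ, dualTerm (d ^ (-J)) (Φ l) (Φ' l) f g k) +
          ∑ j ∈ Finset.Ico J J', ∑ l, ∑' k : ℤ, dualTerm (d ^ (-j)) (Ψ l) (Ψ' l) f g k)
      atTop (𝓝 (2 * Real.pi * pairFn f g))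

/-! ### The characterizing conditions -/

/-- The set `dℤ` of the real numbers `d * m` with `m` an integer. -/
def multiples (d : ℝ) : Set ℝ := Set.range fun m : ℤ => d * m

/-- The set of the integers, as real numbers. -/
def integers : Set ℝ := Set.range fun m : ℤ => (m : ℝ)

/-- `∑_l conj (F_l (ξ)) * F'_l (ζ)`. -/
def crossSum {r : ℕ} (F F' : Fin r → ℝ → ℂ) (ξ ζ : ℝ) : ℂ :=
  ∑ l, starRingEnd ℂ (F l ξ) * F' l ζ

/-- The conditions on generators `F`, `G` and `F'`, `G'` that characterize pairs of frequency-based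
nonhomogeneous dual wavelet frames. -/
structure CharConditions (d : ℝ) {r s : ℕ} (F : Fin r → ℝ → ℂ) (G : Fin s → ℝ → ℂ)
    (F' : Fin r → ℝ → ℂ) (G' : Fin s → ℝ → ℂ) : Prop where
  /-- `∑_l conj (F_l (d^(-j) ·)) F'_l (d^(-j) ·) → 1` in the sense of distributions. -/
  tendsto_one : ∀ h : TestFn,
    Tendsto (fun j : ℕ =>
        pairFn (fun ξ => crossSum F F' (d ^ (-(j : ℤ)) * ξ) (d ^ (-(j : ℤ)) * ξ)) h)
      atTop (𝓝 (pairFn (fun _ => 1) h))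
  two_scale : ∀ k ∈ integers ∩ multiples d, ∀ᵐ ξ : ℝ,
    crossSum F F' ξ (ξ + 2 * Real.pi * k) + crossSum G G' ξ (ξ + 2 * Real.pi * k) =
      crossSum F F' (d⁻¹ * ξ) (d⁻¹ * (ξ + 2 * Real.pi * k))
  vanish_integers : ∀ k ∈ integers \ multiples d, ∀ᵐ ξ : ℝ,
    crossSum F F' ξ (ξ + 2 * Real.pi * k) + crossSum G G' ξ (ξ + 2 * Real.pi * k) = 0
  vanish_multiples : ∀ k ∈ multiples d \ integers, ∀ᵐ ξ : ℝ,
    crossSum F F' ξ (ξ + 2 * Real.pi * d⁻¹ * k) = 0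

/-- The distributions `Φ` and `Ψ` are locally square integrable functions that satisfy the
characterizing conditions, with the dual generators equal to the primal ones. -/
def SatisfiesCharConditions (d : ℝ) {r s : ℕ} (Φ : Fin r → Distr) (Ψ : Fin s → Distr) : Prop :=
  ∃ (F : Fin r → ℝ → ℂ) (G : Fin s → ℝ → ℂ),
    (∀ l, LocL2 (F l) ∧ IsGivenBy (Φ l) (F l)) ∧
    (∀ l, LocL2 (G l) ∧ IsGivenBy (Ψ l) (G l)) ∧
    CharConditions d F G F G

end WaveletFrames

end

open WaveletFrames

open scoped ComplexConjugate

namespace WaveletFrames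

/-! ### Parseval's identity for periodizations -/

/-! Fix one dilation `lam`. For bounded `f`, `g` with bounded support, the coefficients against a
locally square integrable generator `F` are Fourier coefficients at the integers of `F(y) * conj f(y
/ lam)`. Periodizing and applying Parseval turns the sum over `k` into `2π` times a finite sum over
shifts `n` of integrals of `f(x) * conj g(x + 2πn/lam)` against `conj F(lam x) * F(lam x + 2πn)`
(`hasSum_conj_coef_mul`, `levelSum_eq`).

Measured in units of `2π/lam`, the shifts at level `lam` run over `ℤ` and those at the next level
`d⁻¹ * lam` over `dℤ`. Indexing all of them by a real `κ`, the quantity (level of `F`) + (level of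
`G`) - (next level of `F`) becomes a sum of integrals against `defect` (`levelSum_add_sub`), and the
three algebraic relations of the characterization say exactly that every defect vanishes almost
everywhere. If they vanish, the partial sums telescope to a single level of `F`, for which only the
zero shift survives at small dilations; its limit is the normalization at the origin
(`tendsto_levelSum_iff`). Conversely, the expansion at level `J`, tested on dilated functions, is
the expansion at `J + 1`; subtracting the two gives the two-scale identity for all test functions,
and discreteness of `ℤ ∪ dℤ` lets localized `f`, `g` isolate each defect
(`defect_eq_zero_of_levelSum`). The relations do not mention `J`, so one level yields all levels.

Generators that are only distributions become square integrable because, for `f = g`, the expansion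
has nonnegative terms: each coefficient is bounded by the `L²` norm, and Riesz representation
applies (`IsDualFramePair.exists_memLp`). Polarization and density link expansions with energy
identities, and Plancherel gives the time-domain form. For the homogeneous system `J → -∞`: the
energy of the coarse level vanishes on functions supported away from the origin, which are dense
(`tendsto_levelEnergy_zero`). -/

/-- Polarized Parseval identity on the circle. -/
theorem hasSum_conj_fourierCoeff_mul {T : ℝ} [hT : Fact (0 < T)]
    (f g : Lp ℂ 2 (AddCircle.haarAddCircle (T := T))) :
    HasSum (fun k : ℤ => conj (fourierCoeff f k) * fourierCoeff g k) (inner ℂ f g) := by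
  have key := (fourierBasis (T := T)).hasSum_inner_mul_inner f g
  refine key.congr_fun fun k => ?_
  rw [← fourierBasis_repr, ← fourierBasis_repr, HilbertBasis.repr_apply_apply,
    HilbertBasis.repr_apply_apply, inner_conj_symm]

/-- Polarized Parseval identity on the unit interval. -/
theorem hasSum_conj_fourierCoeffOn_mul {p q : ℝ → ℂ}
    (hp : MemLp p 2 (volume.restrict (Set.Ioc 0 1)))
    (hq : MemLp q 2 (volume.restrict (Set.Ioc 0 1))) :
    HasSum (fun k : ℤ => conj (fourierCoeffOn (zero_lt_one (α := ℝ)) p k) *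
      fourierCoeffOn (zero_lt_one (α := ℝ)) q k) (∫ x in (0 : ℝ)..1, conj (p x) * q x) := by
  have hT : Fact ((0 : ℝ) < 1) := ⟨zero_lt_one⟩
  have hp' : MemLp p 2 (volume.restrict (Set.Ioc 0 (0 + 1))) := by rwa [zero_add]
  have hq' : MemLp q 2 (volume.restrict (Set.Ioc 0 (0 + 1))) := by rwa [zero_add]
  have h1 := hp'.memLp_liftIoc.haarAddCircle
  have h2 := hq'.memLp_liftIoc.haarAddCircle
  -- `fourierCoeff_liftIoc_eq` produces the endpoint `0 + 1`, on which a proof argument depends;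
  -- generalizing the endpoint allows substitution.
  have hend : ∀ (b : ℝ) (h : 0 < b) (f : ℝ → ℂ) (k : ℤ), b = 1 →
      fourierCoeffOn h f k = fourierCoeffOn (zero_lt_one (α := ℝ)) f k := by
    rintro _ _ _ _ rfl
    rfl
  have key := hasSum_conj_fourierCoeff_mul h1.toLp h2.toLp
  have e3 : inner ℂ h1.toLp h2.toLp = ∫ x in (0 : ℝ)..1, conj (p x) * q x := by
    rw [L2.inner_def]
    have : ∫ a, inner ℂ ((h1.toLp _) a) ((h2.toLp _) a) ∂AddCircle.haarAddCircle =
        ∫ a, AddCircle.liftIoc 1 0 (fun x => conj (p x) * q x) a ∂AddCircle.haarAddCircle := by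
      apply integral_congr_ae
      filter_upwards [h1.coeFn_toLp, h2.coeFn_toLp] with x hx hy
      rw [hx, hy, RCLike.inner_apply']
      rfl
    rw [this, AddCircle.integral_haarAddCircle, AddCircle.integral_liftIoc_eq_intervalIntegral]
    simp
  rw [e3, fourierCoeff_congr_ae h1.coeFn_toLp, fourierCoeff_congr_ae h2.coeFn_toLp] at key
  refine key.congr_fun fun k => ?_
  rw [fourierCoeff_liftIoc_eq, fourierCoeff_liftIoc_eq, hend _ _ _ _ (zero_add 1),
    hend _ _ _ _ (zero_add 1)]

/-- The Fourier integral `∫ H(t) exp(-2π i k t) dt`. -/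
noncomputable def fourierInt (H : ℝ → ℂ) (k : ℤ) : ℂ :=
  ∫ t, H t * Complex.exp (-(2 * Real.pi * Complex.I * k * t))

theorem fourierCoeffOn_zero_one (p : ℝ → ℂ) (k : ℤ) :
    fourierCoeffOn (zero_lt_one (α := ℝ)) p k =
      ∫ t in (0 : ℝ)..1, p t * Complex.exp (-(2 * Real.pi * Complex.I * k * t)) := by
  rw [fourierCoeffOn_eq_integral]
  simp only [sub_zero, div_one, one_smul]
  refine intervalIntegral.integral_congr fun x _ => ?_
  simp only [smul_eq_mul]
  rw [mul_comm, fourier_coe_apply]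
  congr 2
  push_cast
  field_simp
  ring

/-- An integral of a function supported in `(-M, M]` as a finite sum over unit intervals. -/
theorem integral_eq_sum_intervalIntegral {h : ℝ → ℂ} {M : ℕ} (hh : Integrable h)
    (hs : ∀ x, x ∉ Set.Ioc (-(M : ℝ)) M → h x = 0) :
    ∫ x, h x = ∑ m ∈ Finset.Ico (-(M : ℤ)) M, ∫ x in (0 : ℝ)..1, h (x + m) := by
  refine hh.hasSum_intervalIntegral_comp_add_int.unique (hasSum_sum_of_ne_finset_zero ?_)
  intro m hm
  rw [intervalIntegral.integral_of_le zero_le_one]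
  -- If `x ∈ (0, 1]` and `x + m ∈ (-M, M]`, then `-M - 1 < m < M`, so `m` lies in the half-open
  -- integer interval.
  refine setIntegral_eq_zero_of_forall_eq_zero fun x hx => hs _ fun hx' => hm ?_
  rw [Finset.mem_Ico]
  have h1 : (-(M : ℝ) - 1) < m := by linarith [hx.1, hx.2, hx'.1, hx'.2]
  have h2 : (m : ℝ) < M := by linarith [hx.1, hx.2, hx'.1, hx'.2]
  have h1' : (-(M : ℤ) - 1) < m := by exact_mod_cast h1
  have h2' : m < (M : ℤ) := by exact_mod_cast h2
  omega

theorem MemLp.comp_add_right_real {f : ℝ → ℂ} {p : ℝ≥0∞} (hf : MemLp f p) (c : ℝ) :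
    MemLp (fun x => f (x + c)) p :=
  hf.comp_measurePreserving (measurePreserving_add_right volume c)

theorem integrable_conj_mul {f g : ℝ → ℂ} {μ : Measure ℝ} (hf : MemLp f 2 μ) (hg : MemLp g 2 μ) :
    Integrable (fun x => conj (f x) * g x) μ := by
  have : MemLp (fun x => conj (f x)) 2 μ := hf.star
  exact this.integrable_mul hg

theorem exp_add_int (k m : ℤ) (x : ℝ) :
    Complex.exp (-(2 * Real.pi * Complex.I * k * ((x + m : ℝ) : ℂ))) =
      Complex.exp (-(2 * Real.pi * Complex.I * k * x)) := by
  rw [Complex.exp_eq_exp_iff_exists_int]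
  refine ⟨-(k * m), ?_⟩
  push_cast
  ring

theorem integrable_of_memLp_of_bounded {H : ℝ → ℂ} {M : ℕ} (hH : MemLp H 2)
    (hs : ∀ x, x ∉ Set.Ioc (-(M : ℝ)) M → H x = 0) : Integrable H := by
  have : IntegrableOn H (Set.Ioc (-(M : ℝ)) M) :=
    (hH.restrict _).integrable (by norm_num)
  rw [← integrableOn_iff_integrable_of_support_subset (s := Set.Ioc (-(M : ℝ)) M)]
  · exact this
  · intro x hx
    by_contra h
    exact hx (hs x h)

theorem norm_cexp_fourier (k : ℤ) (t : ℝ) :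
    ‖Complex.exp (-(2 * Real.pi * Complex.I * k * t))‖ = 1 := by
  rw [show -(2 * Real.pi * Complex.I * k * t : ℂ) = ((-(2 * Real.pi * k * t) : ℝ) : ℂ) * Complex.I by
    push_cast; ring, Complex.norm_exp_ofReal_mul_I]

/-- **Parseval's identity** for the Fourier coefficients at the integers of square integrable
functions with bounded support. -/
theorem hasSum_conj_fourierInt_mul {H K : ℝ → ℂ} {M : ℕ} (hH : MemLp H 2) (hK : MemLp K 2)
    (hHs : ∀ x, x ∉ Set.Ioc (-(M : ℝ)) M → H x = 0)
    (hKs : ∀ x, x ∉ Set.Ioc (-(M : ℝ)) M → K x = 0) :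
    HasSum (fun k : ℤ => conj (fourierInt H k) * fourierInt K k)
      (∑' n : ℤ, ∫ t, conj (H t) * K (t + n)) := by
  set s := Finset.Ico (-(M : ℤ)) M with hsdef
  have hper : ∀ G : ℝ → ℂ, MemLp G 2 → MemLp (fun x => ∑ m ∈ s, G (x + m)) 2 := fun G hG =>
    memLp_finsetSum s fun m _ => MemLp.comp_add_right_real hG m
  -- The exponentials are 1-periodic, so the Fourier integral over the line is the Fourier
  -- coefficient of the periodization, here a finite sum.
  have hcoef : ∀ G : ℝ → ℂ, MemLp G 2 → (∀ x, x ∉ Set.Ioc (-(M : ℝ)) M → G x = 0) → ∀ k : ℤ,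
      fourierInt G k = fourierCoeffOn (zero_lt_one (α := ℝ)) (fun x => ∑ m ∈ s, G (x + m)) k := by
    intro G hG hGs k
    have hi := integrable_of_memLp_of_bounded hG hGs
    have hi2 : Integrable fun t : ℝ => G t * Complex.exp (-(2 * Real.pi * Complex.I * k * t)) := by
      refine hi.mul_bdd (c := 1) (by fun_prop) (ae_of_all _ fun t => ?_)
      rw [norm_cexp_fourier]
    rw [fourierCoeffOn_zero_one, fourierInt, integral_eq_sum_intervalIntegral hi2
      (fun x hx => by rw [hGs x hx, zero_mul]), ← intervalIntegral.integral_finsetSum]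
    · refine intervalIntegral.integral_congr fun x _ => ?_
      simp only [exp_add_int, Finset.sum_mul, hsdef]
    · intro m _
      exact (hi2.comp_add_right (m : ℝ)).intervalIntegrable
  have main := hasSum_conj_fourierCoeffOn_mul ((hper H hH).restrict (Set.Ioc 0 1))
    ((hper K hK).restrict (Set.Ioc 0 1))
  simp only [← hcoef H hH hHs, ← hcoef K hK hKs] at main
  have hint : ∀ m n : ℤ, Integrable fun x : ℝ => conj (H (x + m)) * K (x + n) := fun m n =>
    integrable_conj_mul (MemLp.comp_add_right_real hH m) (MemLp.comp_add_right_real hK n)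
  convert main using 1
  have r1 : ∫ x in (0 : ℝ)..1, conj (∑ m ∈ s, H (x + m)) * ∑ m ∈ s, K (x + m) =
      ∑ m ∈ s, ∑ n ∈ s, ∫ x in (0 : ℝ)..1, conj (H (x + m)) * K (x + n) := by
    simp only [map_sum, Finset.sum_mul_sum]
    rw [intervalIntegral.integral_finsetSum fun m _ =>
      (integrable_finsetSum _ fun n _ => hint m n).intervalIntegrable]
    refine Finset.sum_congr rfl fun m _ => ?_
    rw [intervalIntegral.integral_finsetSum fun n _ => (hint m n).intervalIntegrable]
  rw [r1]
  have hzero : ∀ m n : ℤ, n ∉ s → ∫ x in (0 : ℝ)..1, conj (H (x + m)) * K (x + n) = 0 := by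
    intro m n hn
    rw [intervalIntegral.integral_of_le zero_le_one]
    refine setIntegral_eq_zero_of_forall_eq_zero fun x hx => ?_
    rw [hKs, mul_zero]
    intro hx'
    refine hn ?_
    rw [hsdef, Finset.mem_Ico]
    have h1 : (-(M : ℝ) - 1) < n := by linarith [hx.1, hx.2, hx'.1, hx'.2]
    have h2 : (n : ℝ) < M := by linarith [hx.1, hx.2, hx'.1, hx'.2]
    have h1' : (-(M : ℤ) - 1) < n := by exact_mod_cast h1
    have h2' : n < (M : ℤ) := by exact_mod_cast h2
    omega
  -- Both sides are now the same double sum over unit intervals: in `r1` the translates of `H` and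
  -- `K` are indexed by `m` and `n`, here by `m` and the difference of the two.
  have r2 : ∀ n : ℤ, ∫ t, conj (H t) * K (t + n) =
      ∑ m ∈ s, ∫ x in (0 : ℝ)..1, conj (H (x + m)) * K (x + (m + n : ℤ)) := by
    intro n
    have := hint 0 n
    simp only [Int.cast_zero, add_zero] at this
    rw [integral_eq_sum_intervalIntegral this fun x hx => by rw [hHs x hx]; simp]
    simp only [Int.cast_add, add_assoc, hsdef]
  have hfin : ∀ m : ℤ, HasSum (fun n : ℤ => ∫ x in (0 : ℝ)..1, conj (H (x + m)) * K (x + (m + n : ℤ)))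
      (∑ n ∈ s, ∫ x in (0 : ℝ)..1, conj (H (x + m)) * K (x + n)) := by
    intro m
    have := hasSum_sum_of_ne_finset_zero (L := .unconditional ℤ) (hzero m)
    exact (Equiv.addLeft m).hasSum_iff.2 this
  simp only [r2]
  rw [Summable.tsum_finsetSum fun m _ => (hfin m).summable]
  exact Finset.sum_congr rfl fun m _ => (hfin m).tsum_eq

/-! ### Dilations of functions in `L^p` -/

theorem map_mul_left_volume {a : ℝ} (ha : a ≠ 0) :
    Measure.map (a * ·) (volume : Measure ℝ) = ENNReal.ofReal |a⁻¹| • volume :=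
  Real.map_volume_mul_left ha

theorem eLpNorm_comp_mul_left (f : ℝ → ℂ) (p : ℝ≥0∞) {a : ℝ} (ha : a ≠ 0) :
    eLpNorm (fun x => f (a * x)) p volume = eLpNorm f p (ENNReal.ofReal |a⁻¹| • volume) := by
  rw [← map_mul_left_volume ha]
  exact ((Homeomorph.mulLeft₀ a ha).measurableEmbedding.eLpNorm_map_measure (g := f)).symm

theorem MemLp.comp_mul_left_real {f : ℝ → ℂ} {p : ℝ≥0∞} (hf : MemLp f p) {a : ℝ} (ha : a ≠ 0) :
    MemLp (fun x => f (a * x)) p := by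
  have h : MemLp f p (Measure.map (a * ·) (volume : Measure ℝ)) := by
    rw [map_mul_left_volume ha]
    exact hf.smul_measure ENNReal.ofReal_ne_top
  exact h.comp_of_map (by fun_prop)

theorem eLpNorm_two_comp_mul_left_sq (f : ℝ → ℂ) {a : ℝ} (ha : a ≠ 0) :
    eLpNorm (fun x => f (a * x)) 2 volume ^ 2 =
      ENNReal.ofReal |a⁻¹| * eLpNorm f 2 volume ^ 2 := by
  rw [eLpNorm_comp_mul_left f 2 ha, eLpNorm_smul_measure_of_ne_top (by norm_num), smul_eq_mul,
    mul_pow, ← ENNReal.rpow_natCast, ← ENNReal.rpow_mul]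
  norm_num

theorem quasiMeasurePreserving_mul_left {a : ℝ} (ha : a ≠ 0) :
    Measure.QuasiMeasurePreserving (fun x : ℝ => a * x) volume volume := by
  refine ⟨by fun_prop, ?_⟩
  rw [map_mul_left_volume ha]
  exact Measure.smul_absolutelyContinuous

theorem eLpNorm_two_comp_add_right (f : ℝ → ℂ) (p : ℝ≥0∞) (b : ℝ) :
    eLpNorm (fun x => f (x + b)) p volume = eLpNorm f p volume := by
  have := (Homeomorph.addRight b).measurableEmbedding.eLpNorm_map_measure (g := f) (p := p)
    (μ := (volume : Measure ℝ))
  rw [show Measure.map (Homeomorph.addRight b) (volume : Measure ℝ) = volume from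
    (measurePreserving_add_right volume b).map_eq] at this
  exact this.symm

/-! ### Bounded functions with bounded support -/

/-- Essentially bounded functions that vanish outside a bounded set. -/
def BddSupp (f : ℝ → ℂ) : Prop :=
  MemLp f ⊤ volume ∧ ∃ R : ℝ, ∀ x, R < |x| → f x = 0

theorem BddSupp.of_testFn (f : TestFn) : BddSupp f := by
  refine ⟨f.memLp_top, ?_⟩
  obtain ⟨R, hR⟩ := f.hasCompactSupport.isBounded.subset_closedBall 0
  refine ⟨R, fun x hx => image_eq_zero_of_notMem_tsupport fun h => ?_⟩
  have := hR h
  rw [mem_closedBall_zero_iff, Real.norm_eq_abs] at this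
  linarith

theorem BddSupp.memLp_two {f : ℝ → ℂ} (hf : BddSupp f) : MemLp f 2 := by
  obtain ⟨R, hR⟩ := hf.2
  have h1 : MemLp f 2 (volume.restrict (Set.Icc (-R) R)) :=
    (hf.1.restrict _).mono_exponent le_top
  rw [← memLp_indicator_iff_restrict measurableSet_Icc] at h1
  convert h1
  ext x
  by_cases hx : x ∈ Set.Icc (-R) R
  · simp [hx]
  · rw [Set.indicator_of_notMem hx]
    refine hR x (lt_of_not_ge fun h => hx (abs_le.1 h))

theorem LocL2.of_memLp {F : ℝ → ℂ} (hF : MemLp F 2) : LocL2 F :=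
  ⟨hF.1, fun _ _ => hF.restrict _⟩

/-- The bounded support of `f` cuts `F` to a compact set, where it is square integrable, and `f` is
essentially bounded. Smoothness plays no role, which later allows cutoffs by indicators. -/
theorem LocL2.memLp_mul_conj {F f : ℝ → ℂ} (hF : LocL2 F) (hf : BddSupp f) {lam : ℝ}
    (hl : lam ≠ 0) : MemLp (fun y => F y * conj (f (y / lam))) 2 := by
  obtain ⟨R, hR⟩ := hf.2
  have h1 := hF.2 (Set.Icc (-(R * |lam|)) (R * |lam|)) isCompact_Icc
  rw [← memLp_indicator_iff_restrict measurableSet_Icc] at h1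
  have h2 : MemLp (fun y => conj (f (lam⁻¹ * y))) ⊤ :=
    (MemLp.comp_mul_left_real hf.1 (inv_ne_zero hl)).star
  refine (h2.mul h1).ae_eq (ae_of_all _ fun y => ?_)
  simp only [Pi.mul_apply]
  by_cases hy : y ∈ Set.Icc (-(R * |lam|)) (R * |lam|)
  · rw [Set.indicator_of_mem hy, div_eq_inv_mul]
  · rw [Set.indicator_of_notMem hy, hR (y / lam), map_zero, zero_mul, mul_zero]
    rw [abs_div, lt_div_iff₀ (abs_pos.2 hl)]
    exact lt_of_not_ge fun h => hy (abs_le.1 h)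

/-! ### Coefficients and their Bessel sums -/

/-- The coefficient `|lam| ^ (-1/2) * ∫ F(y) * conj (f (y / lam)) * exp (-i k y) dy`. -/
noncomputable def coef (F : ℝ → ℂ) (lam : ℝ) (f : ℝ → ℂ) (k : ℤ) : ℂ :=
  (Real.sqrt |lam| : ℂ)⁻¹ * ∫ y, F y * conj (f (y / lam)) * Complex.exp (-(Complex.I * k * y))

/-- The substitution `y = 2πt` makes the kernel 1-periodic, ready for Parseval on the unit interval.
-/
theorem coef_eq_fourierInt (F : ℝ → ℂ) (lam : ℝ) (f : ℝ → ℂ) (k : ℤ) :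
    coef F lam f k = (Real.sqrt |lam| : ℂ)⁻¹ * (2 * Real.pi *
      fourierInt (fun t => F (2 * Real.pi * t) * conj (f (2 * Real.pi * t / lam))) k) := by
  have h := Measure.integral_comp_mul_left
    (fun y : ℝ => F y * conj (f (y / lam)) * Complex.exp (-(Complex.I * k * y))) (2 * Real.pi)
  have hp : (0 : ℝ) < 2 * Real.pi := Real.two_pi_pos
  rw [abs_of_pos (inv_pos.2 hp)] at h
  have e : ∫ y : ℝ, F y * conj (f (y / lam)) * Complex.exp (-(Complex.I * k * y)) =
      2 * Real.pi * fourierInt (fun t => F (2 * Real.pi * t) * conj (f (2 * Real.pi * t / lam))) k := by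
    have h3 : fourierInt (fun t => F (2 * Real.pi * t) * conj (f (2 * Real.pi * t / lam))) k =
        (2 * Real.pi)⁻¹ • ∫ y : ℝ, F y * conj (f (y / lam)) * Complex.exp (-(Complex.I * k * y)) := by
      rw [← h, fourierInt]
      refine integral_congr_ae (ae_of_all _ fun t => ?_)
      simp only
      congr 2
      push_cast
      ring
    rw [h3, Complex.real_smul]
    push_cast
    field_simp
  rw [coef, e]

/-- The integrand of the Bessel formula. -/
noncomputable def shiftInt (f g : ℝ → ℂ) (c : ℝ) (w : ℝ → ℂ) : ℂ :=
  ∫ x, f x * conj (g (x + c)) * w x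

theorem BddSupp.exists_common {f g : ℝ → ℂ} (hf : BddSupp f) (hg : BddSupp g) :
    ∃ R : ℝ, 0 < R ∧ (∀ x, R < |x| → f x = 0) ∧ ∀ x, R < |x| → g x = 0 := by
  obtain ⟨R, hR⟩ := hf.2
  obtain ⟨R', hR'⟩ := hg.2
  refine ⟨max 1 (max R R'), by positivity, fun x hx => hR x ?_, fun x hx => hR' x ?_⟩
  · exact lt_of_le_of_lt ((le_max_left _ _).trans (le_max_right _ _)) hx
  · exact lt_of_le_of_lt ((le_max_right _ _).trans (le_max_right _ _)) hx

theorem shiftInt_eq_zero {f g : ℝ → ℂ} {R c : ℝ} (hf : ∀ x, R < |x| → f x = 0)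
    (hg : ∀ x, R < |x| → g x = 0) (hc : 2 * R < |c|) (w : ℝ → ℂ) : shiftInt f g c w = 0 := by
  refine integral_eq_zero_of_ae (ae_of_all _ fun x => ?_)
  simp only [Pi.zero_apply]
  by_cases hx : R < |x|
  · rw [hf x hx, zero_mul, zero_mul]
  · rw [hg (x + c), map_zero, mul_zero, zero_mul]
    have := abs_sub_abs_le_abs_sub c (-x)
    rw [abs_neg, sub_neg_eq_add, add_comm c x] at this
    linarith

/-- The sum over the integers of the products of two coefficients. -/
theorem hasSum_conj_coef_mul {F f g : ℝ → ℂ} (hF : LocL2 F) (hf : BddSupp f) (hg : BddSupp g)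
    {lam : ℝ} (hl : lam ≠ 0) :
    HasSum (fun k : ℤ => conj (coef F lam f k) * coef F lam g k)
      (2 * Real.pi * ∑' n : ℤ, shiftInt f g (2 * Real.pi * n / lam)
        fun x => conj (F (lam * x)) * F (lam * x + 2 * Real.pi * n)) := by
  obtain ⟨R, hR0, hfR, hgR⟩ := hf.exists_common hg
  have hp : (0 : ℝ) < 2 * Real.pi := Real.two_pi_pos
  have hlp : 0 < |lam| := abs_pos.2 hl
  set H : (ℝ → ℂ) → ℝ → ℂ := fun f t => F (2 * Real.pi * t) * conj (f (2 * Real.pi * t / lam))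
    with hHdef
  have hH : ∀ f, BddSupp f → MemLp (H f) 2 := fun f hf =>
    MemLp.comp_mul_left_real (hF.memLp_mul_conj hf hl) hp.ne'
  obtain ⟨M, hM⟩ := exists_nat_gt (R * |lam| / (2 * Real.pi))
  rw [div_lt_iff₀ hp] at hM
  have hHs : ∀ f : ℝ → ℂ, (∀ x, R < |x| → f x = 0) →
      ∀ x, x ∉ Set.Ioc (-(M : ℝ)) M → H f x = 0 := by
    intro f hf x hx
    have hx' : (M : ℝ) ≤ |x| := by
      by_contra h
      push Not at h
      exact hx ⟨(abs_lt.1 h).1, (abs_lt.1 h).2.le⟩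
    simp only [hHdef]
    rw [hf, map_zero, mul_zero]
    rw [abs_div, lt_div_iff₀ hlp, abs_mul, abs_of_pos hp]
    nlinarith
  have main := hasSum_conj_fourierInt_mul (hH f hf) (hH g hg) (hHs f hfR) (hHs g hgR)
  -- The factor is the product of the normalizations of the two coefficients. Substituting `x =
  -- 2πt/lam` in the integrals contributes `|lam|/(2π)`, so that `2π` remains.
  have main2 := main.mul_left (((|lam| : ℝ) : ℂ)⁻¹ * (2 * Real.pi) ^ 2)
  have hsq : (Real.sqrt |lam| : ℂ)⁻¹ * (Real.sqrt |lam| : ℂ)⁻¹ = ((|lam| : ℝ) : ℂ)⁻¹ := by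
    rw [← mul_inv, ← Complex.ofReal_mul, Real.mul_self_sqrt (abs_nonneg _)]
  refine HasSum.congr_fun (a := _) (Eq.subst (motive := fun z => HasSum _ z) ?_ main2) fun k => ?_
  rotate_left
  · rw [coef_eq_fourierInt, coef_eq_fourierInt, ← hsq]
    simp only [map_mul, map_inv₀, Complex.conj_ofReal, map_ofNat]
    ring
  · have e : ∀ n : ℤ, ∫ t, conj (H f t) * H g (t + n) = (|lam| * (2 * Real.pi)⁻¹ : ℝ) •
        shiftInt f g (2 * Real.pi * n / lam)
          fun x => conj (F (lam * x)) * F (lam * x + 2 * Real.pi * n) := by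
      intro n
      have h := Measure.integral_comp_mul_left (fun x : ℝ => f x *
        conj (g (x + 2 * Real.pi * n / lam)) *
        (conj (F (lam * x)) * F (lam * x + 2 * Real.pi * n))) (2 * Real.pi / lam)
      rw [inv_div, abs_div, abs_of_pos hp] at h
      rw [shiftInt, ← div_eq_mul_inv, ← h]
      refine integral_congr_ae (ae_of_all _ fun t => ?_)
      simp only [hHdef, map_mul, Complex.conj_conj]
      rw [show lam * (2 * Real.pi / lam * t) = 2 * Real.pi * t by field_simp,
        show 2 * Real.pi * (t + n) = 2 * Real.pi * t + 2 * Real.pi * n by ring,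
        show 2 * Real.pi / lam * t = 2 * Real.pi * t / lam by ring,
        show (2 * Real.pi * t + 2 * Real.pi * n) / lam =
          2 * Real.pi * t / lam + 2 * Real.pi * n / lam by ring]
      ring
    simp only [e, Complex.real_smul]
    rw [tsum_mul_left, ← mul_assoc]
    congr 1
    have : ((|lam| : ℝ) : ℂ) ≠ 0 := by exact_mod_cast hlp.ne'
    push_cast
    field_simp

/-- Far shifts separate the supports. All sums over shifts are thus finite, and their rearrangements
raise no question of convergence. -/
theorem finite_support_shiftInt {f g : ℝ → ℂ} (hf : BddSupp f) (hg : BddSupp g)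
    {c : ℝ} (hc : c ≠ 0) (w : ℝ → ℝ → ℂ) :
    (Function.support fun n : ℤ => shiftInt f g (c * n) (w n)).Finite := by
  obtain ⟨R, hR0, hfR, hgR⟩ := hf.exists_common hg
  obtain ⟨M, hM⟩ := exists_nat_gt (2 * R / |c|)
  have hcp := abs_pos.2 hc
  rw [div_lt_iff₀ hcp] at hM
  refine (Set.finite_Icc (-(M : ℤ)) M).subset fun n hn => ?_
  by_contra h
  refine hn (shiftInt_eq_zero hfR hgR ?_ _)
  rw [abs_mul]
  have : (M : ℝ) ≤ |(n : ℝ)| := by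
    rw [Set.mem_Icc, ← abs_le] at h
    push Not at h
    exact_mod_cast h.le
  nlinarith

/-- The integrand is the product of two square integrable functions, once each copy of `F` is
grouped with the compactly cut factor that localizes it. -/
theorem LocL2.integrable_shift {F f g : ℝ → ℂ} (hF : LocL2 F) (hf : BddSupp f) (hg : BddSupp g)
    {lam : ℝ} (hl : lam ≠ 0) (c : ℝ) :
    Integrable fun x => f x * conj (g (x + c / lam)) * (conj (F (lam * x)) * F (lam * x + c)) := by
  have h1 := MemLp.comp_mul_left_real (hF.memLp_mul_conj hf hl) hl
  have h2 := MemLp.comp_mul_left_real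
    (MemLp.comp_add_right_real (hF.memLp_mul_conj hg hl) c) hl
  refine (integrable_conj_mul h1 h2).congr (ae_of_all _ fun x => ?_)
  simp only [map_mul, Complex.conj_conj]
  rw [mul_div_cancel_left₀ _ hl, add_div, mul_div_cancel_left₀ _ hl]
  ring

theorem summable_norm_conj_coef_mul {F f g : ℝ → ℂ} (hF : LocL2 F) (hf : BddSupp f)
    (hg : BddSupp g) {lam : ℝ} (hl : lam ≠ 0) :
    Summable fun k : ℤ => ‖conj (coef F lam f k) * coef F lam g k‖ :=
  (hasSum_conj_coef_mul hF hf hg hl).summable.norm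

/-- The sum of `⟨f, h⟩ ⟨h, g⟩` over the functions `h` of one level of a system. -/
noncomputable def levelSum {r : ℕ} (F : Fin r → ℝ → ℂ) (lam : ℝ) (f g : ℝ → ℂ) : ℂ :=
  ∑ l, ∑' k : ℤ, conj (coef (F l) lam f k) * coef (F l) lam g k

theorem levelSum_eq {r : ℕ} {F : Fin r → ℝ → ℂ} {f g : ℝ → ℂ} (hF : ∀ l, LocL2 (F l))
    (hf : BddSupp f) (hg : BddSupp g) {lam : ℝ} (hl : lam ≠ 0) :
    levelSum F lam f g = 2 * Real.pi * ∑' n : ℤ, shiftInt f g (2 * Real.pi * n / lam)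
      fun x => crossSum F F (lam * x) (lam * x + 2 * Real.pi * n) := by
  have hp : (2 * Real.pi / lam) ≠ 0 := div_ne_zero Real.two_pi_pos.ne' hl
  rw [levelSum]
  simp only [fun l => (hasSum_conj_coef_mul (hF l) hf hg hl).tsum_eq]
  rw [← Finset.mul_sum, ← Summable.tsum_finsetSum]
  · congr 2
    ext n
    simp only [shiftInt, crossSum]
    rw [← integral_finsetSum _ fun l _ => (hF l).integrable_shift hf hg hl _]
    simp only [Finset.mul_sum]
  · intro l _
    apply summable_of_hasFiniteSupport
    have := finite_support_shiftInt hf hg hp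
      fun n x => conj (F l (lam * x)) * F l (lam * x + 2 * Real.pi * n)
    rw [Function.HasFiniteSupport]
    simpa only [mul_div_right_comm] using this

/-! ### Test functions and square integrable distributions -/

theorem conjTest_apply (f : TestFn) (x : ℝ) : conjTest f x = conj (f x) := rfl

theorem conjTest_conjTest (f : TestFn) : conjTest (conjTest f) = f := by
  ext x
  simp [conjTest_apply]

theorem dualTdm_apply (lam k n : ℝ) (hl : lam ≠ 0) (h : TestFn) (y : ℝ) :
    dualTdm lam k n hl h y = h ((y + k) / lam) * dualMultiplier lam k n y := rfl

theorem dualTdm_zero_zero_apply (lam : ℝ) (hl : lam ≠ 0) (h : TestFn) (y : ℝ) :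
    dualTdm lam 0 0 hl h y = h (y / lam) * (Real.sqrt |lam| : ℂ)⁻¹ := by
  simp [dualTdm_apply, dualMultiplier]

/-- A smooth function with compact support as a test function. -/
def mkTestFn (g : ℝ → ℂ) (h1 : ContDiff ℝ (⊤ : ℕ∞) g) (h2 : HasCompactSupport g) : TestFn where
  toFun := g
  contDiff' := h1
  hasCompactSupport' := h2
  tsupport_subset' := fun _ _ => trivial

theorem TestFn.memLp_two (f : TestFn) : MemLp f 2 := (BddSupp.of_testFn f).memLp_two

/-- The inclusion of the test functions into `L²`. -/
noncomputable def testToLp : TestFn →ₗ[ℂ] Lp ℂ 2 (volume : Measure ℝ) where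
  toFun h := (TestFn.memLp_two h).toLp
  map_add' f g := by
    rw [← MemLp.toLp_add]
    rfl
  map_smul' c f := by
    rw [RingHom.id_apply, ← MemLp.toLp_const_smul]
    rfl

theorem coeFn_testToLp (f : TestFn) : testToLp f =ᵐ[volume] f :=
  MemLp.coeFn_toLp (TestFn.memLp_two f)

theorem denseRange_testToLp : DenseRange testToLp := by
  refine (MeasureTheory.Lp.dense_hasCompactSupport_contDiff (F := ℂ) (p := 2)
    (μ := (volume : Measure ℝ)) (by norm_num)).mono ?_
  rintro f ⟨g, hfg, h2, h1⟩
  refine ⟨mkTestFn g h1 h2, ?_⟩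
  apply Lp.ext
  exact (coeFn_testToLp _).trans hfg.symm

theorem norm_testToLp (f : TestFn) : ‖testToLp f‖ = (eLpNorm f 2 volume).toReal :=
  Lp.norm_toLp _ (TestFn.memLp_two f)

/-- A distribution that is bounded for the `L²` norm is a square integrable function. -/
theorem exists_memLp_isGivenBy {u : Distr} {C : ℝ}
    (hu : ∀ h : TestFn, ‖u h‖ ≤ C * (eLpNorm h 2 volume).toReal) :
    ∃ F : ℝ → ℂ, MemLp F 2 ∧ IsGivenBy u F := by
  have hb : ∃ C, ∀ h : TestFn, ‖(u : TestFn →ₗ[ℂ] ℂ) h‖ ≤ C * ‖testToLp h‖ :=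
    ⟨C, fun h => by rw [norm_testToLp]; exact hu h⟩
  set G := (InnerProductSpace.toDual ℂ (Lp ℂ 2 (volume : Measure ℝ))).symm
    ((u : TestFn →ₗ[ℂ] ℂ).extendOfNorm testToLp) with hG
  -- The inner product is conjugate linear in its first slot, so the density of `u` is the conjugate
  -- of the Riesz representative.
  have hGm : MemLp (fun x => conj (G x)) 2 := (Lp.memLp G).star
  refine ⟨fun x => conj (G x), hGm, hGm.locallyIntegrable (by norm_num), fun h => ?_⟩
  have h1 : inner ℂ G (testToLp h) = u h := by
    rw [hG, InnerProductSpace.toDual_symm_apply, LinearMap.extendOfNorm_eq denseRange_testToLp hb]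
    rfl
  rw [← h1, L2.inner_def]
  refine integral_congr_ae ?_
  filter_upwards [coeFn_testToLp h] with x hx
  rw [hx, RCLike.inner_apply']

/-! ### Pairings of distributions given by functions -/

theorem IsGivenBy.congr {u : Distr} {F F' : ℝ → ℂ} (h : IsGivenBy u F) (hF : F =ᵐ[volume] F') :
    IsGivenBy u F' := by
  refine ⟨h.1.congr hF, fun g => ?_⟩
  rw [h.2]
  refine integral_congr_ae ?_
  filter_upwards [hF] with x hx
  rw [hx]

theorem distr_tdm_apply (u : Distr) (lam k n : ℝ) (hl : lam ≠ 0) (h : TestFn) :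
    u.tdm lam k n h = u (dualTdm lam k n hl h) := by
  rw [Distr.tdm, dif_pos hl]
  rfl

theorem IsGivenBy.pairDT_tdm {u : Distr} {F : ℝ → ℂ} (h : IsGivenBy u F) {lam : ℝ} (hl : lam ≠ 0)
    (k : ℤ) (f : TestFn) : pairDT (u.tdm lam 0 k) f = coef F lam f k := by
  rw [pairDT, distr_tdm_apply _ _ _ _ hl, h.2, coef, ← integral_const_mul]
  refine integral_congr_ae (ae_of_all _ fun y => ?_)
  simp only [dualTdm_apply, dualMultiplier, conjTest_apply]
  simp only [add_zero, Complex.ofReal_zero, Complex.ofReal_intCast, neg_mul]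
  ring

/-- Substitute `y = lam * x`. Together with `IsGivenBy.pairDT_tdm` this identifies the `L²`
coefficients with the distributional ones, up to conjugation. -/
theorem pairFn_tdm {f F : ℝ → ℂ} {lam : ℝ} (hl : lam ≠ 0) (k : ℤ) :
    pairFn f (tdm F lam 0 k) = conj (coef F lam f k) := by
  have hs : (Real.sqrt |lam| : ℂ) ≠ 0 := by
    exact_mod_cast (Real.sqrt_pos.2 (abs_pos.2 hl)).ne'
  have h := Measure.integral_comp_mul_left
    (fun y : ℝ => conj (F y * conj (f (y / lam)) * Complex.exp (-(Complex.I * k * y)))) lam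
  rw [pairFn, coef, map_mul, ← integral_conj]
  have e : ∫ x, f x * conj (tdm F lam 0 k x) = (Real.sqrt |lam| : ℂ) *
      ∫ x, conj (F (lam * x) * conj (f (lam * x / lam)) *
        Complex.exp (-(Complex.I * k * (lam * x : ℝ)))) := by
    rw [← integral_const_mul]
    refine integral_congr_ae (ae_of_all _ fun x => ?_)
    simp only [tdm, map_mul, Complex.conj_conj, Complex.conj_ofReal, mul_div_cancel_left₀ _ hl,
      sub_zero, Complex.ofReal_mul, Complex.ofReal_intCast, ← Complex.exp_conj, map_neg,
      Complex.conj_I, map_intCast]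
    ring_nf
  rw [e, h, Complex.real_smul, map_inv₀, Complex.conj_ofReal, ← mul_assoc]
  congr 1
  rw [abs_inv, Complex.ofReal_inv]
  nth_rewrite 2 [← Real.mul_self_sqrt (abs_nonneg lam)]
  rw [Complex.ofReal_mul]
  field_simp

theorem IsGivenBy.dualTerm_eq {u : Distr} {F : ℝ → ℂ} (h : IsGivenBy u F) {lam : ℝ}
    (hl : lam ≠ 0) (f g : TestFn) (k : ℤ) :
    dualTerm lam u u f g k = conj (coef F lam f k) * coef F lam g k := by
  rw [dualTerm, pairTD, h.pairDT_tdm hl, h.pairDT_tdm hl]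

/-! ### Unitary dilations of test functions -/

theorem eLpNorm_dualTdm (lam : ℝ) (hl : lam ≠ 0) (h : TestFn) :
    eLpNorm (dualTdm lam 0 0 hl h) 2 volume = eLpNorm h 2 volume := by
  have e : (dualTdm lam 0 0 hl h : ℝ → ℂ) =
      (Real.sqrt |lam| : ℂ)⁻¹ • fun y : ℝ => h (lam⁻¹ * y) := by
    ext y
    rw [dualTdm_zero_zero_apply, Pi.smul_apply, smul_eq_mul, mul_comm, div_eq_inv_mul]
  have hs := Real.sqrt_pos.2 (abs_pos.2 hl)
  have key : eLpNorm (dualTdm lam 0 0 hl h) 2 volume ^ 2 = eLpNorm h 2 volume ^ 2 := by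
    rw [e, eLpNorm_const_smul, mul_pow, eLpNorm_two_comp_mul_left_sq _ (inv_ne_zero hl),
      ← mul_assoc]
    convert one_mul _
    rw [inv_inv, enorm_inv (by exact_mod_cast hs.ne'), ← ofReal_norm, Complex.norm_real,
      Real.norm_of_nonneg hs.le, ← ENNReal.ofReal_inv_of_pos hs, ← ENNReal.ofReal_pow (by positivity),
      ← ENNReal.ofReal_mul (by positivity), inv_pow, Real.sq_sqrt (abs_nonneg _),
      inv_mul_cancel₀ (abs_pos.2 hl).ne', ENNReal.ofReal_one]
  exact (ENNReal.pow_right_strictMono two_ne_zero).injective key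

theorem pairFn_dualTdm (lam : ℝ) (hl : lam ≠ 0) (f g : TestFn) :
    pairFn (dualTdm lam 0 0 hl f) (dualTdm lam 0 0 hl g) = pairFn f g := by
  have h := Measure.integral_comp_mul_left (fun y : ℝ => f y * conj (g y)) lam⁻¹
  have hs := Real.sqrt_pos.2 (abs_pos.2 hl)
  have hs' : (Real.sqrt |lam| : ℂ) ≠ 0 := by exact_mod_cast hs.ne'
  have e : pairFn (dualTdm lam 0 0 hl f) (dualTdm lam 0 0 hl g) =
      ((|lam| : ℝ) : ℂ)⁻¹ * ∫ x, f (lam⁻¹ * x) * conj (g (lam⁻¹ * x)) := by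
    rw [pairFn, ← integral_const_mul]
    refine integral_congr_ae (ae_of_all _ fun x => ?_)
    simp only [dualTdm_zero_zero_apply, map_mul, map_inv₀, Complex.conj_ofReal, div_eq_inv_mul]
    -- This also expands the `|lam|` under the square roots; the next rewrite restores those.
    rw [← Real.mul_self_sqrt (abs_nonneg lam), Complex.ofReal_mul]
    rw [Real.mul_self_sqrt (abs_nonneg lam)]
    field_simp
  rw [e, h, inv_inv, Complex.real_smul, ← mul_assoc, inv_mul_cancel₀, one_mul, pairFn]
  exact_mod_cast (abs_pos.2 hl).ne'

/-- A unitary dilation of the test function moves the system by one level. This is the source of the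
independence of `J`. -/
theorem coef_dualTdm (F : ℝ → ℂ) {lam d : ℝ} (hl : lam ≠ 0) (hd : d ≠ 0) (f : TestFn) (k : ℤ) :
    coef F lam (dualTdm d⁻¹ 0 0 (inv_ne_zero hd) f) k = coef F (d⁻¹ * lam) f k := by
  have hs := Real.sqrt_pos.2 (abs_pos.2 hl)
  have hs' : (Real.sqrt |lam| : ℂ) ≠ 0 := by exact_mod_cast hs.ne'
  have hd' : (Real.sqrt |d| : ℂ) ≠ 0 := by
    exact_mod_cast (Real.sqrt_pos.2 (abs_pos.2 hd)).ne'
  rw [coef, coef, ← integral_const_mul, ← integral_const_mul]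
  refine integral_congr_ae (ae_of_all _ fun x => ?_)
  simp only [dualTdm_zero_zero_apply, map_mul, map_inv₀, Complex.conj_ofReal]
  rw [show x / (d⁻¹ * lam) = x / lam / d⁻¹ by field_simp, abs_mul, abs_inv,
    Real.sqrt_mul (by positivity), Real.sqrt_inv]
  push_cast
  field_simp

/-! ### The defect of the two-scale relations -/

/-- Sums over `ℤ` and over `dℤ` are moved to the common index set `ℝ`, where they can be compared
term by term whatever the arithmetic nature of `d`. -/
theorem tsum_int_eq_finsum {a : ℝ → ℂ} {c : ℝ} (hc : c ≠ 0)
    (ha : (Function.support fun n : ℤ => a (c * n)).Finite) :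
    ∑' n : ℤ, a (c * n) = ∑ᶠ κ : ℝ, (multiples c).indicator a κ := by
  have hinj : Function.Injective fun n : ℤ => c * (n : ℝ) := fun m n h => by
    simpa [hc] using h
  rw [tsum_eq_finsum (f := fun n : ℤ => a (c * n)) ha, ← finsum_mem_range hinj,
    finsum_mem_def]
  rfl

theorem finite_support_indicator {a : ℝ → ℂ} {c : ℝ}
    (ha : (Function.support fun n : ℤ => a (c * n)).Finite) :
    (Function.support ((multiples c).indicator a)).Finite := by
  refine (ha.image fun n : ℤ => c * (n : ℝ)).subset ?_
  intro κ hκ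
  rw [Set.support_indicator] at hκ
  obtain ⟨⟨n, rfl⟩, h2⟩ := hκ
  exact ⟨n, h2, rfl⟩

theorem integers_eq : integers = multiples 1 := by
  simp [integers, multiples]

open scoped Classical in
/-- The difference of the two sides of the two-scale relations with index `κ`. -/
noncomputable def defect (d : ℝ) {r s : ℕ} (F : Fin r → ℝ → ℂ) (G : Fin s → ℝ → ℂ)
    (κ ξ : ℝ) : ℂ :=
  (if κ ∈ integers then crossSum F F ξ (ξ + 2 * Real.pi * κ) +
      crossSum G G ξ (ξ + 2 * Real.pi * κ) else 0) -
    if κ ∈ multiples d then crossSum F F (d⁻¹ * ξ) (d⁻¹ * (ξ + 2 * Real.pi * κ)) else 0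

theorem integrable_shift_crossSum {r : ℕ} {F : Fin r → ℝ → ℂ} {f g : ℝ → ℂ}
    (hF : ∀ l, LocL2 (F l)) (hf : BddSupp f) (hg : BddSupp g) {lam : ℝ} (hl : lam ≠ 0) (c : ℝ) :
    Integrable fun x => f x * conj (g (x + c / lam)) * crossSum F F (lam * x) (lam * x + c) := by
  simp only [crossSum, Finset.mul_sum]
  exact integrable_finsetSum _ fun l _ => (hF l).integrable_shift hf hg hl c

section Defect

variable {d : ℝ} {r s : ℕ} {F : Fin r → ℝ → ℂ} {G : Fin s → ℝ → ℂ} {f g : ℝ → ℂ} {lam : ℝ}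

theorem integrable_shift_dilate (hF : ∀ l, LocL2 (F l)) (hf : BddSupp f) (hg : BddSupp g)
    (hd : d ≠ 0) (hl : lam ≠ 0) (κ : ℝ) :
    Integrable fun x => f x * conj (g (x + 2 * Real.pi * κ / lam)) *
      crossSum F F (d⁻¹ * (lam * x)) (d⁻¹ * (lam * x + 2 * Real.pi * κ)) := by
  have h := integrable_shift_crossSum hF hf hg (mul_ne_zero (inv_ne_zero hd) hl)
    (d⁻¹ * (2 * Real.pi * κ))
  refine h.congr (ae_of_all _ fun x => ?_)
  simp only
  rw [mul_div_mul_left _ _ (inv_ne_zero hd), mul_assoc d⁻¹ lam x, ← mul_add d⁻¹]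

theorem integrable_shift_defect (hF : ∀ l, LocL2 (F l)) (hG : ∀ l, LocL2 (G l))
    (hf : BddSupp f) (hg : BddSupp g) (hd : d ≠ 0) (hl : lam ≠ 0) (κ : ℝ) :
    Integrable fun x => f x * conj (g (x + 2 * Real.pi * κ / lam)) * defect d F G κ (lam * x) := by
  simp only [defect, mul_sub]
  refine Integrable.sub ?_ ?_
  · split_ifs
    · simp only [mul_add]
      exact (integrable_shift_crossSum hF hf hg hl _).add (integrable_shift_crossSum hG hf hg hl _)
    · simp
  · split_ifs
    · exact integrable_shift_dilate hF hf hg hd hl κ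
    · simp

theorem shiftInt_defect (hF : ∀ l, LocL2 (F l)) (hG : ∀ l, LocL2 (G l))
    (hf : BddSupp f) (hg : BddSupp g) (hd : d ≠ 0) (hl : lam ≠ 0) (κ : ℝ) :
    shiftInt f g (2 * Real.pi * κ / lam) (fun x => defect d F G κ (lam * x)) =
      integers.indicator (fun κ => shiftInt f g (2 * Real.pi * κ / lam)
          (fun x => crossSum F F (lam * x) (lam * x + 2 * Real.pi * κ)) +
        shiftInt f g (2 * Real.pi * κ / lam)
          (fun x => crossSum G G (lam * x) (lam * x + 2 * Real.pi * κ))) κ -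
      (multiples d).indicator (fun κ => shiftInt f g (2 * Real.pi * κ / lam)
        (fun x => crossSum F F (d⁻¹ * (lam * x)) (d⁻¹ * (lam * x + 2 * Real.pi * κ)))) κ := by
  have h1 := integrable_shift_crossSum hF hf hg hl (2 * Real.pi * κ)
  have h2 := integrable_shift_crossSum hG hf hg hl (2 * Real.pi * κ)
  have h3 := integrable_shift_dilate hF hf hg hd hl κ
  classical
  simp only [Set.indicator_apply]
  simp only [defect, shiftInt, mul_sub]
  rw [integral_sub]
  · congr 1
    · split_ifs
      · simp only [mul_add]
        rw [integral_add h1 h2]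
      · simp
    · split_ifs
      · rfl
      · simp
  · split_ifs
    · simp only [mul_add]
      exact h1.add h2
    · simp
  · split_ifs
    · exact h3
    · simp

/-- The two-scale identity between three levels, up to the defects. -/
theorem levelSum_add_sub (hF : ∀ l, LocL2 (F l)) (hG : ∀ l, LocL2 (G l))
    (hf : BddSupp f) (hg : BddSupp g) (hd : d ≠ 0) (hl : lam ≠ 0) :
    levelSum F lam f g + levelSum G lam f g - levelSum F (d⁻¹ * lam) f g =
      2 * Real.pi * ∑ᶠ κ : ℝ, shiftInt f g (2 * Real.pi * κ / lam)
        fun x => defect d F G κ (lam * x) := by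
  have hp : (2 * Real.pi / lam) ≠ 0 := div_ne_zero Real.two_pi_pos.ne' hl
  have hfin : ∀ {r : ℕ} (F : Fin r → ℝ → ℂ), (Function.support fun n : ℤ =>
      shiftInt f g (2 * Real.pi * (1 * n) / lam)
        fun x => crossSum F F (lam * x) (lam * x + 2 * Real.pi * (1 * n))).Finite := by
    intro r F
    have := finite_support_shiftInt hf hg hp
      fun n x => crossSum F F (lam * x) (lam * x + 2 * Real.pi * n)
    simpa only [mul_div_right_comm, one_mul] using this
  have hfin2 : (Function.support fun n : ℤ => shiftInt f g (2 * Real.pi * (d * n) / lam)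
      fun x => crossSum F F (d⁻¹ * (lam * x)) (d⁻¹ * (lam * x + 2 * Real.pi * (d * n)))).Finite := by
    have := finite_support_shiftInt hf hg (mul_ne_zero hp hd)
      fun n x => crossSum F F (d⁻¹ * (lam * x)) (d⁻¹ * (lam * x + 2 * Real.pi * (d * n)))
    simpa only [mul_div_right_comm, mul_assoc] using this
  simp only [shiftInt_defect hF hG hf hg hd hl, integers_eq, Set.indicator_add]
  rw [finsum_sub_distrib, finsum_add_distrib]
  · rw [← tsum_int_eq_finsum one_ne_zero (hfin F), ← tsum_int_eq_finsum one_ne_zero (hfin G),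
      ← tsum_int_eq_finsum hd hfin2, levelSum_eq hF hf hg hl, levelSum_eq hG hf hg hl,
      levelSum_eq hF hf hg (mul_ne_zero (inv_ne_zero hd) hl), mul_sub, mul_add]
    simp only [one_mul]
    -- At dilation `d⁻¹ * lam` the shift `2πn / (d⁻¹ * lam)` equals `2π(d n)/lam`, so it carries the
    -- index `κ = d n`.
    congr 3
    ext n
    congr 1
    · field_simp
    · ext x
      rw [mul_add, mul_assoc]
      congr 2
      field_simp
  · exact finite_support_indicator (hfin F)
  · exact finite_support_indicator (hfin G)
  · exact ((finite_support_indicator (hfin F)).union (finite_support_indicator (hfin G))).subset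
      (Function.support_add _ _)
  · exact finite_support_indicator hfin2

theorem ae_comp_mul_left {p : ℝ → Prop} (h : ∀ᵐ x : ℝ, p x) {a : ℝ} (ha : a ≠ 0) :
    ∀ᵐ x : ℝ, p (a * x) :=
  (quasiMeasurePreserving_mul_left ha).ae h

/-- The four cases of membership of `κ` in `ℤ` and `dℤ` are the three relations and a trivial case.
The last relation is stated in the variable `d⁻¹ * ξ`, hence the dilation of the null set. -/
theorem CharConditions.defect_eq_zero (h : CharConditions d F G F G) (hd : d ≠ 0) (κ : ℝ) :
    ∀ᵐ ξ : ℝ, defect d F G κ ξ = 0 := by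
  by_cases h1 : κ ∈ integers <;> by_cases h2 : κ ∈ multiples d
  · filter_upwards [h.two_scale κ ⟨h1, h2⟩] with ξ hξ
    rw [defect, if_pos h1, if_pos h2, hξ, sub_self]
  · filter_upwards [h.vanish_integers κ ⟨h1, h2⟩] with ξ hξ
    rw [defect, if_pos h1, if_neg h2, hξ, sub_self]
  · filter_upwards [ae_comp_mul_left (h.vanish_multiples κ ⟨h2, h1⟩) (inv_ne_zero hd)] with ξ hξ
    rw [defect, if_neg h1, if_pos h2, mul_add, zero_sub, neg_eq_zero, ← hξ]
    congr 2
    ring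
  · refine ae_of_all _ fun ξ => ?_
    rw [defect, if_neg h1, if_neg h2, sub_self]

theorem charConditions_of_defect (hd : d ≠ 0) (h : ∀ κ, ∀ᵐ ξ : ℝ, defect d F G κ ξ = 0)
    (h1 : ∀ h : TestFn, Tendsto (fun j : ℕ =>
        pairFn (fun ξ => crossSum F F (d ^ (-(j : ℤ)) * ξ) (d ^ (-(j : ℤ)) * ξ)) h)
      atTop (𝓝 (pairFn (fun _ => 1) h))) : CharConditions d F G F G where
  tendsto_one := h1
  two_scale κ hκ := by
    filter_upwards [h κ] with ξ hξ
    rwa [defect, if_pos hκ.1, if_pos hκ.2, sub_eq_zero] at hξ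
  vanish_integers κ hκ := by
    filter_upwards [h κ] with ξ hξ
    rwa [defect, if_pos hκ.1, if_neg hκ.2, sub_zero] at hξ
  vanish_multiples κ hκ := by
    filter_upwards [ae_comp_mul_left (h κ) hd] with ξ hξ
    rw [defect, if_neg hκ.2, if_pos hκ.1, zero_sub, neg_eq_zero, mul_add,
      inv_mul_cancel_left₀ hd] at hξ
    rw [← hξ]
    congr 2
    ring

/-- The three levels telescope if the defects vanish. -/
theorem levelSum_add_eq (hF : ∀ l, LocL2 (F l)) (hG : ∀ l, LocL2 (G l))
    (hf : BddSupp f) (hg : BddSupp g) (hd : d ≠ 0) (hl : lam ≠ 0)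
    (h : ∀ κ, ∀ᵐ ξ : ℝ, defect d F G κ ξ = 0) :
    levelSum F lam f g + levelSum G lam f g = levelSum F (d⁻¹ * lam) f g := by
  rw [← sub_eq_zero, levelSum_add_sub hF hG hf hg hd hl]
  have : ∀ κ, shiftInt f g (2 * Real.pi * κ / lam) (fun x => defect d F G κ (lam * x)) = 0 := by
    intro κ
    refine integral_eq_zero_of_ae ?_
    filter_upwards [ae_comp_mul_left (h κ) hl] with x hx
    rw [hx, mul_zero]
    rfl
  simp [this]

/-! ### Recovering each defect by localization. -/

/-- A union of two lattices is locally finite, although `ε` must depend on `κ₀`: for irrational `d`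
points of `ℤ` and `dℤ` come arbitrarily close. -/
theorem exists_isolated_index (hd : d ≠ 0) (κ₀ : ℝ) :
    ∃ ε > 0, ∀ κ ∈ integers ∪ multiples d, |κ - κ₀| < ε → κ = κ₀ := by
  have hfin : ∀ c : ℝ, c ≠ 0 → (multiples c ∩ Set.Icc (κ₀ - 1) (κ₀ + 1)).Finite := by
    intro c hc
    obtain ⟨M, hM⟩ := exists_nat_gt ((|κ₀| + 1) / |c|)
    have hcp := abs_pos.2 hc
    rw [div_lt_iff₀ hcp] at hM
    refine ((Set.finite_Icc (-(M : ℤ)) M).image fun n : ℤ => c * (n : ℝ)).subset ?_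
    rintro _ ⟨⟨n, rfl⟩, hn⟩
    refine ⟨n, ?_, rfl⟩
    by_contra h
    have : (M : ℝ) ≤ |(n : ℝ)| := by
      rw [Set.mem_Icc, ← abs_le] at h
      push Not at h
      exact_mod_cast h.le
    have h3 : |c * n| ≤ |κ₀| + 1 := by
      have h4 : |c * n - κ₀| ≤ 1 := abs_le.2 ⟨by linarith [hn.1], by linarith [hn.2]⟩
      have := abs_sub_abs_le_abs_sub (c * n) κ₀
      linarith
    rw [abs_mul] at h3
    nlinarith
  have hfin' : ((integers ∪ multiples d) ∩ Set.Icc (κ₀ - 1) (κ₀ + 1)).Finite := by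
    rw [Set.union_inter_distrib_right, integers_eq]
    exact (hfin 1 one_ne_zero).union (hfin d hd)
  have hnhds := (hfin'.sdiff (t := {κ₀})).isClosed.isOpen_compl.mem_nhds
    (show κ₀ ∈ _ from fun h => h.2 rfl)
  obtain ⟨ε, hε, hball⟩ := Metric.mem_nhds_iff.1 hnhds
  refine ⟨min ε 1, by positivity, fun κ hκ hlt => ?_⟩
  by_contra hne
  refine hball (Metric.mem_ball.2 (lt_of_lt_of_le hlt (min_le_left _ _))) ⟨⟨hκ, ?_⟩, hne⟩
  have := abs_lt.1 (lt_of_lt_of_le hlt (min_le_right _ _))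
  constructor <;> linarith

theorem bddSupp_indicator (R : ℝ) : BddSupp ((Set.Icc (-R) R).indicator fun _ => (1 : ℂ)) := by
  refine ⟨memLp_indicator_const _ measurableSet_Icc _ (Or.inr (by simp)), R, fun x hx => ?_⟩
  rw [Set.indicator_of_notMem]
  intro h
  exact absurd (abs_le.2 h) (not_le.2 hx)

/-- Take for both `f` and `g` the indicator of an interval so long that `f(x)` and `g(x + c)` are 1
on the given compact set; the integrability of the shifted products then applies to the defect
itself. -/
theorem locallyIntegrable_defect (hF : ∀ l, LocL2 (F l)) (hG : ∀ l, LocL2 (G l))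
    (hd : d ≠ 0) (hl : lam ≠ 0) (κ : ℝ) :
    LocallyIntegrable fun x => defect d F G κ (lam * x) := by
  rw [locallyIntegrable_iff]
  intro K hK
  obtain ⟨R, hR⟩ := hK.isBounded.subset_closedBall 0
  set c := 2 * Real.pi * κ / lam with hc
  have h := (integrable_shift_defect hF hG (bddSupp_indicator (R + |c|))
    (bddSupp_indicator (R + |c|)) hd hl κ).integrableOn (s := K)
  refine h.congr_fun_ae ?_
  refine (ae_restrict_iff' hK.measurableSet).2 (ae_of_all _ fun x hx => ?_)
  have hx' : |x| ≤ R := by simpa using hR hx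
  have h1 : x ∈ Set.Icc (-(R + |c|)) (R + |c|) := abs_le.1 (by linarith [abs_nonneg c])
  have h2 : x + c ∈ Set.Icc (-(R + |c|)) (R + |c|) := abs_le.1 (by linarith [abs_add_le x c])
  simp only
  rw [Set.indicator_of_mem h1, Set.indicator_of_mem h2]
  simp

/-- If the three levels telescope for all test functions, then the defects vanish. -/
theorem defect_eq_zero_of_levelSum (hF : ∀ l, LocL2 (F l)) (hG : ∀ l, LocL2 (G l))
    (hd : d ≠ 0) (hl : lam ≠ 0)
    (h : ∀ f g : TestFn, levelSum F lam f g + levelSum G lam f g = levelSum F (d⁻¹ * lam) f g)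
    (κ₀ : ℝ) : ∀ᵐ ξ : ℝ, defect d F G κ₀ ξ = 0 := by
  obtain ⟨ε, hε, hiso⟩ := exists_isolated_index hd κ₀
  have hlp : 0 < |lam| := abs_pos.2 hl
  have hp : (0 : ℝ) < 2 * Real.pi := Real.two_pi_pos
  -- `f` will live in a ball of radius `δ` and `g` in one of radius `2δ`, so an index `κ`
  -- contributes only if `|2π(κ - κ₀)/lam| < 3δ`, that is `|κ - κ₀| < ε`.
  set δ := 2 * Real.pi * ε / (3 * |lam|) with hδ
  have hδ0 : 0 < δ := by positivity
  have hloc := locallyIntegrable_defect hF hG hd hl κ₀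
  have key : ∀ x₀ : ℝ, ∀ᵐ x : ℝ, x ∈ Metric.ball x₀ δ → defect d F G κ₀ (lam * x) = 0 := by
    intro x₀
    refine Metric.isOpen_ball.ae_eq_zero_of_integral_contDiff_smul_eq_zero
      (hloc.locallyIntegrableOn _) ?_
    intro φ hφ hφc hφs
    -- The plateau of the bump covers the translated support of `φ`, so the term of index `κ₀` is
    -- the plain integral of `φ` against the defect.
    let b : ContDiffBump (x₀ + 2 * Real.pi * κ₀ / lam) := ⟨δ, 2 * δ, hδ0, by linarith⟩
    let f : TestFn := mkTestFn (fun x => (φ x : ℂ)) (Complex.ofRealCLM.contDiff.comp hφ)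
      (hφc.comp_left (g := fun x : ℝ => (x : ℂ)) Complex.ofReal_zero)
    let g : TestFn := mkTestFn (fun x => (b x : ℂ)) (Complex.ofRealCLM.contDiff.comp b.contDiff)
      (b.hasCompactSupport.comp_left (g := fun x : ℝ => (x : ℂ)) Complex.ofReal_zero)
    have hf0 : ∀ x, x ∉ Metric.ball x₀ δ → f x = 0 := fun x hx => by
      change (φ x : ℂ) = 0
      rw [image_eq_zero_of_notMem_tsupport fun h => hx (hφs h), Complex.ofReal_zero]
    have hz := levelSum_add_sub hF hG (BddSupp.of_testFn f) (BddSupp.of_testFn g) hd hl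
    rw [h, sub_self, finsum_eq_single _ κ₀] at hz
    · have hz' := (mul_eq_zero.1 hz.symm).resolve_left (by exact_mod_cast hp.ne')
      rw [← hz', shiftInt]
      refine integral_congr_ae (ae_of_all _ fun x => ?_)
      simp only
      by_cases hx : x ∈ Metric.ball x₀ δ
      · have : b (x + 2 * Real.pi * κ₀ / lam) = 1 := by
          refine b.one_of_mem_closedBall ?_
          rw [Metric.mem_closedBall, dist_add_right]
          exact (Metric.mem_ball.1 hx).le
        change φ x • _ = (φ x : ℂ) * conj ((b (x + 2 * Real.pi * κ₀ / lam) : ℝ) : ℂ) * _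
        rw [this, Complex.real_smul]
        simp
      · have h0 := hf0 x hx
        change (φ x : ℂ) = 0 at h0
        change φ x • _ = (φ x : ℂ) * _ * _
        rw [Complex.real_smul, h0]
        simp
    · intro κ hκ
      by_cases hmem : κ ∈ integers ∪ multiples d
      · refine integral_eq_zero_of_ae (ae_of_all _ fun x => ?_)
        simp only [Pi.zero_apply]
        by_cases hx : x ∈ Metric.ball x₀ δ
        · have : b (x + 2 * Real.pi * κ / lam) = 0 := by
            refine b.zero_of_le_dist ?_
            by_contra hlt
            push Not at hlt
            refine hκ (hiso κ hmem ?_)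
            change dist _ _ < 2 * δ at hlt
            rw [Real.dist_eq] at hlt
            have hx' := Metric.mem_ball.1 hx
            rw [Real.dist_eq] at hx'
            have e : 2 * Real.pi * (κ - κ₀) / lam =
                (x + 2 * Real.pi * κ / lam - (x₀ + 2 * Real.pi * κ₀ / lam)) - (x - x₀) := by ring
            have h3 : |2 * Real.pi * (κ - κ₀) / lam| < 3 * δ := by
              rw [e]
              refine lt_of_le_of_lt (abs_sub _ _) ?_
              linarith
            rw [abs_div, abs_mul, abs_of_pos hp, div_lt_iff₀ hlp, hδ] at h3
            have e2 : 3 * (2 * Real.pi * ε / (3 * |lam|)) * |lam| = 2 * Real.pi * ε := by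
              field_simp
            rw [e2] at h3
            exact lt_of_mul_lt_mul_left h3 hp.le
          change f x * conj ((b (x + 2 * Real.pi * κ / lam) : ℝ) : ℂ) * _ = 0
          rw [this]
          simp
        · rw [hf0 x hx, zero_mul, zero_mul]
      · rw [Set.mem_union, not_or] at hmem
        simp [shiftInt, defect, if_neg hmem.1, if_neg hmem.2]
  have hall : ∀ᵐ x : ℝ, defect d F G κ₀ (lam * x) = 0 := by
    refine measure_null_of_locally_null _ fun x _ => ?_
    refine ⟨{y | ¬ (y ∈ Metric.ball x δ → defect d F G κ₀ (lam * y) = 0)}, ?_, key x⟩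
    rw [mem_nhdsWithin]
    refine ⟨Metric.ball x δ, Metric.isOpen_ball, Metric.mem_ball_self hδ0, ?_⟩
    rintro y ⟨hy1, hy2⟩ hy3
    exact hy2 (hy3 hy1)
  filter_upwards [ae_comp_mul_left hall (inv_ne_zero hl)] with ξ hξ
  rwa [mul_inv_cancel_left₀ hl] at hξ

end Defect

/-! ### Telescoping and the dual frame expansion -/

section Telescope

variable {d : ℝ} {r s : ℕ} {F : Fin r → ℝ → ℂ} {G : Fin s → ℝ → ℂ}

theorem ne_zero_of_one_lt_abs (hd : 1 < |d|) : d ≠ 0 := by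
  rintro rfl
  norm_num at hd

theorem sum_Ico_int_succ (u : ℤ → ℂ) {J n : ℤ} (h : J ≤ n) :
    ∑ j ∈ Finset.Ico J (n + 1), u j = ∑ j ∈ Finset.Ico J n, u j + u n := by
  have : Finset.Ico J (n + 1) = insert n (Finset.Ico J n) := by
    ext x
    simp only [Finset.mem_Ico, Finset.mem_insert]
    omega
  rw [this, Finset.sum_insert (by simp), add_comm]

theorem sum_Ico_int_eq_add (u : ℤ → ℂ) {J n : ℤ} (h : J < n) :
    ∑ j ∈ Finset.Ico J n, u j = u J + ∑ j ∈ Finset.Ico (J + 1) n, u j := by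
  have : Finset.Ico J n = insert J (Finset.Ico (J + 1) n) := by
    ext x
    simp only [Finset.mem_Ico, Finset.mem_insert]
    omega
  rw [this, Finset.sum_insert (by simp)]

theorem sum_Ico_int_shift (u : ℤ → ℂ) (J n : ℤ) :
    ∑ j ∈ Finset.Ico J n, u (j + 1) = ∑ j ∈ Finset.Ico (J + 1) (n + 1), u j := by
  rw [← Finset.map_add_right_Ico, Finset.sum_map]
  rfl

theorem zpow_neg_succ (hd : d ≠ 0) (j : ℤ) : d⁻¹ * d ^ (-j) = d ^ (-(j + 1)) := by
  rw [neg_add, zpow_add₀ hd, zpow_neg_one, mul_comm]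

/-- For small dilations only the diagonal term of the Bessel formula remains. -/
theorem levelSum_eq_integral {f g : ℝ → ℂ} {lam R : ℝ} (hF : ∀ l, LocL2 (F l)) (hf : BddSupp f)
    (hg : BddSupp g) (hfR : ∀ x, R < |x| → f x = 0) (hgR : ∀ x, R < |x| → g x = 0)
    (hl : lam ≠ 0) (hR : |lam| * (2 * R) < 2 * Real.pi) :
    levelSum F lam f g =
      2 * Real.pi * ∫ x, f x * conj (g x) * crossSum F F (lam * x) (lam * x) := by
  rw [levelSum_eq hF hf hg hl, tsum_eq_single 0]
  · simp [shiftInt]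
  · intro n hn
    refine shiftInt_eq_zero hfR hgR ?_ _
    have h1 : (1 : ℝ) ≤ |(n : ℝ)| := by exact_mod_cast Int.one_le_abs hn
    rw [abs_div, abs_mul, abs_of_pos Real.two_pi_pos, lt_div_iff₀ (abs_pos.2 hl)]
    nlinarith [Real.two_pi_pos]

theorem eventually_abs_zpow_mul_lt (hd : 1 < |d|) (R : ℝ) :
    ∀ᶠ j : ℕ in atTop, |d ^ (-(j : ℤ))| * (2 * R) < 2 * Real.pi := by
  have h : Tendsto (fun j : ℕ => |d|⁻¹ ^ j * (2 * R)) atTop (𝓝 (0 * (2 * R))) :=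
    (tendsto_pow_atTop_nhds_zero_of_lt_one (by positivity) (inv_lt_one_of_one_lt₀ hd)).mul_const _
  rw [zero_mul] at h
  filter_upwards [h.eventually_lt_const Real.two_pi_pos] with j hj
  rwa [zpow_neg, abs_inv, zpow_natCast, abs_pow, ← inv_pow]

theorem tendsto_int_iff_nat {u : ℤ → ℂ} {a : ℂ} :
    Tendsto u atTop (𝓝 a) ↔ Tendsto (fun n : ℕ => u n) atTop (𝓝 a) := by
  refine ⟨fun h => h.comp tendsto_natCast_atTop_atTop, fun h => ?_⟩
  have h2 : Tendsto Int.toNat atTop atTop := by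
    refine tendsto_atTop.2 fun b => ?_
    filter_upwards [eventually_ge_atTop (b : ℤ)] with n hn
    omega
  refine (h.comp h2).congr' ?_
  filter_upwards [eventually_ge_atTop 0] with n hn
  simp [Int.toNat_of_nonneg hn]

/-- Convergence of the diagonal terms is the normalization at the origin. -/
theorem tendsto_levelSum_iff (hd : 1 < |d|) (hF : ∀ l, LocL2 (F l)) :
    (∀ h : TestFn, Tendsto (fun j : ℕ =>
        pairFn (fun ξ => crossSum F F (d ^ (-(j : ℤ)) * ξ) (d ^ (-(j : ℤ)) * ξ)) h)
      atTop (𝓝 (pairFn (fun _ => 1) h))) ↔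
    ∀ f g : TestFn, Tendsto (fun j : ℤ => levelSum F (d ^ (-j)) f g) atTop
      (𝓝 (2 * Real.pi * pairFn f g)) := by
  have hd0 := ne_zero_of_one_lt_abs hd
  -- Once only the diagonal term remains, the level sum depends on `f` and `g` through the product
  -- `f * conj g` alone.
  have hl : ∀ f g h : TestFn, (∀ x, conj (h x) = f x * conj (g x)) →
      (Tendsto (fun j : ℤ => levelSum F (d ^ (-j)) f g) atTop (𝓝 (2 * Real.pi * pairFn f g)) ↔
      Tendsto (fun j : ℕ =>
        pairFn (fun ξ => crossSum F F (d ^ (-(j : ℤ)) * ξ) (d ^ (-(j : ℤ)) * ξ)) h)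
      atTop (𝓝 (pairFn (fun _ => 1) h))) := by
    intro f g h hfg
    have hp : (2 * Real.pi : ℂ) ≠ 0 := by exact_mod_cast Real.two_pi_pos.ne'
    obtain ⟨R, -, hfR, hgR⟩ := (BddSupp.of_testFn f).exists_common (BddSupp.of_testFn g)
    have e1 : pairFn (fun _ => 1) h = pairFn f g := by simp [pairFn, hfg]
    have e2 : ∀ᶠ j : ℕ in atTop, levelSum F (d ^ (-(j : ℤ))) f g = 2 * Real.pi *
        pairFn (fun ξ => crossSum F F (d ^ (-(j : ℤ)) * ξ) (d ^ (-(j : ℤ)) * ξ)) h := by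
      filter_upwards [eventually_abs_zpow_mul_lt hd R] with j hj
      rw [levelSum_eq_integral hF (BddSupp.of_testFn f) (BddSupp.of_testFn g) hfR hgR
        (zpow_ne_zero _ hd0) hj, pairFn]
      simp only [hfg]
      congr 2
      ext x
      ring
    rw [tendsto_int_iff_nat, tendsto_congr' e2, e1]
    refine ⟨fun H => ?_, fun H => H.const_mul _⟩
    have := H.const_mul (2 * Real.pi : ℂ)⁻¹
    simpa only [inv_mul_cancel_left₀ hp] using this
  constructor
  · intro H f g
    let h : TestFn := mkTestFn (fun x => conj (f x) * g x)
      ((conjTest f).contDiff.mul g.contDiff) (g.hasCompactSupport.mul_left)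
    refine (hl f g h fun x => ?_).2 (H h)
    change conj (conj (f x) * g x) = _
    simp
  · intro H h
    -- A plateau function writes any `conj h` as such a product, namely `conj h * conj b`.
    obtain ⟨b, hb1⟩ : ∃ b : TestFn, ∀ x ∈ tsupport h, b x = 1 := by
      obtain ⟨R, hR⟩ := h.hasCompactSupport.isBounded.subset_ball 0
      let b : ContDiffBump (0 : ℝ) := ⟨max R 1, max R 1 + 1, by positivity, by linarith⟩
      refine ⟨mkTestFn (fun x => (b x : ℂ)) (Complex.ofRealCLM.contDiff.comp b.contDiff)
        (b.hasCompactSupport.comp_left (g := fun x : ℝ => (x : ℂ)) Complex.ofReal_zero),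
        fun x hx => ?_⟩
      change ((b x : ℝ) : ℂ) = 1
      rw [b.one_of_mem_closedBall, Complex.ofReal_one]
      have := Metric.mem_ball.1 (hR hx)
      exact Metric.mem_closedBall.2 (this.le.trans (le_max_left _ _))
    refine (hl (conjTest h) b h fun x => ?_).1 (H _ _)
    rw [conjTest_apply]
    by_cases hx : x ∈ tsupport h
    · rw [hb1 x hx]
      simp
    · rw [image_eq_zero_of_notMem_tsupport hx]
      simp

/-- The frame expansion of the pairing of test functions, for generating functions. -/
def HasExpansion (d : ℝ) (J : ℤ) {r s : ℕ} (F : Fin r → ℝ → ℂ) (G : Fin s → ℝ → ℂ) : Prop :=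
  ∀ f g : TestFn, Tendsto (fun J' : ℤ => levelSum F (d ^ (-J)) f g +
    ∑ j ∈ Finset.Ico J J', levelSum G (d ^ (-j)) f g) atTop (𝓝 (2 * Real.pi * pairFn f g))

/-- Parseval makes the absolute convergence over `k` automatic for locally square integrable
generators; only the limit over the scales is a condition. -/
theorem isDualFramePair_iff_hasExpansion {Φ : Fin r → Distr} {Ψ : Fin s → Distr}
    (hd : d ≠ 0) (hF : ∀ l, LocL2 (F l)) (hG : ∀ l, LocL2 (G l))
    (hΦ : ∀ l, IsGivenBy (Φ l) (F l)) (hΨ : ∀ l, IsGivenBy (Ψ l) (G l)) (J : ℤ) :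
    IsDualFramePair d J Φ Ψ Φ Ψ ↔ HasExpansion d J F G := by
  have h1 : ∀ (j : ℤ) (l : Fin r) (f g : TestFn) (k : ℤ), dualTerm (d ^ (-j)) (Φ l) (Φ l) f g k =
      conj (coef (F l) (d ^ (-j)) f k) * coef (F l) (d ^ (-j)) g k :=
    fun j l f g k => (hΦ l).dualTerm_eq (zpow_ne_zero _ hd) f g k
  have h2 : ∀ (j : ℤ) (l : Fin s) (f g : TestFn) (k : ℤ), dualTerm (d ^ (-j)) (Ψ l) (Ψ l) f g k =
      conj (coef (G l) (d ^ (-j)) f k) * coef (G l) (d ^ (-j)) g k :=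
    fun j l f g k => (hΨ l).dualTerm_eq (zpow_ne_zero _ hd) f g k
  refine forall₂_congr fun f g => ?_
  simp only [h1, h2]
  have hs1 := fun (j : ℤ) l => summable_norm_conj_coef_mul (hF l) (BddSupp.of_testFn f)
    (BddSupp.of_testFn g) (zpow_ne_zero (-j) hd)
  have hs2 := fun (j : ℤ) l => summable_norm_conj_coef_mul (hG l) (BddSupp.of_testFn f)
    (BddSupp.of_testFn g) (zpow_ne_zero (-j) hd)
  exact ⟨fun h => h.2.2, fun h => ⟨fun l => hs1 J l, fun j _ l => hs2 j l, h⟩⟩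

/-- Test the expansion on dilated functions: every level moves up by one and the pairing is
unchanged. -/
theorem HasExpansion.succ (hd : d ≠ 0) {J : ℤ} (h : HasExpansion d J F G) :
    HasExpansion d (J + 1) F G := by
  intro f g
  have h1 := h (dualTdm d⁻¹ 0 0 (inv_ne_zero hd) f) (dualTdm d⁻¹ 0 0 (inv_ne_zero hd) g)
  have e : ∀ {r : ℕ} (F : Fin r → ℝ → ℂ) (j : ℤ), levelSum F (d ^ (-j))
      (dualTdm d⁻¹ 0 0 (inv_ne_zero hd) f) (dualTdm d⁻¹ 0 0 (inv_ne_zero hd) g) =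
      levelSum F (d ^ (-(j + 1))) f g := by
    intro r F j
    simp only [levelSum, coef_dualTdm _ (zpow_ne_zero _ hd) hd, zpow_neg_succ hd]
  simp only [e, pairFn_dualTdm] at h1
  have h2 : Tendsto (fun n : ℤ => n - 1) atTop atTop := tendsto_atTop_add_const_right _ _ tendsto_id
  refine (h1.comp h2).congr fun n => ?_
  simp only [Function.comp]
  rw [sum_Ico_int_shift (fun j => levelSum G (d ^ (-j)) f g), sub_add_cancel]

/-- The expansions at `J` and `J + 1` have the same limit, and for `J' > J` their partial sums
differ by a constant, which must therefore be zero. -/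
theorem HasExpansion.levelSum_add_eq (hd : d ≠ 0) {J : ℤ} (h : HasExpansion d J F G)
    (f g : TestFn) : levelSum F (d ^ (-J)) f g + levelSum G (d ^ (-J)) f g =
      levelSum F (d⁻¹ * d ^ (-J)) f g := by
  have h1 := (h f g).sub (h.succ hd f g)
  rw [sub_self] at h1
  have h2 : Tendsto (fun _ : ℤ => levelSum F (d ^ (-J)) f g + levelSum G (d ^ (-J)) f g -
      levelSum F (d⁻¹ * d ^ (-J)) f g) atTop (𝓝 0) := by
    refine h1.congr' ?_
    filter_upwards [eventually_gt_atTop J] with n hn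
    rw [sum_Ico_int_eq_add _ hn, zpow_neg_succ hd]
    ring
  exact sub_eq_zero.1 (tendsto_const_nhds_iff.1 h2)

theorem levelSum_add_sum (hd : d ≠ 0) (hF : ∀ l, LocL2 (F l)) (hG : ∀ l, LocL2 (G l))
    (h : ∀ κ, ∀ᵐ ξ : ℝ, defect d F G κ ξ = 0) {f g : ℝ → ℂ} (hf : BddSupp f) (hg : BddSupp g)
    {J n : ℤ} (hn : J ≤ n) : levelSum F (d ^ (-J)) f g +
      ∑ j ∈ Finset.Ico J n, levelSum G (d ^ (-j)) f g = levelSum F (d ^ (-n)) f g := by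
  induction n, hn using Int.leInduction with
  | base => simp
  | succ n hn ih =>
    rw [sum_Ico_int_succ _ hn, ← add_assoc, ih,
      WaveletFrames.levelSum_add_eq hF hG hf hg hd (zpow_ne_zero _ hd) h, zpow_neg_succ hd]

theorem hasExpansion_iff_tendsto (hd : d ≠ 0) (hF : ∀ l, LocL2 (F l)) (hG : ∀ l, LocL2 (G l))
    (h : ∀ κ, ∀ᵐ ξ : ℝ, defect d F G κ ξ = 0) (J : ℤ) : HasExpansion d J F G ↔
      ∀ f g : TestFn, Tendsto (fun j : ℤ => levelSum F (d ^ (-j)) f g) atTop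
        (𝓝 (2 * Real.pi * pairFn f g)) := by
  refine forall₂_congr fun f g => tendsto_congr' ?_
  filter_upwards [eventually_ge_atTop J] with n hn
  exact levelSum_add_sum hd hF hG h (BddSupp.of_testFn f) (BddSupp.of_testFn g) hn

theorem CharConditions.hasExpansion (hd : 1 < |d|) (hF : ∀ l, LocL2 (F l))
    (hG : ∀ l, LocL2 (G l)) (h : CharConditions d F G F G) (J : ℤ) : HasExpansion d J F G := by
  have hd0 := ne_zero_of_one_lt_abs hd
  rw [hasExpansion_iff_tendsto hd0 hF hG (h.defect_eq_zero hd0)]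
  exact (tendsto_levelSum_iff hd hF).1 h.tendsto_one

/-- A two-scale identity at the single level `J` already kills all defects, since these do not
depend on the level; telescoping then reads off the normalization. -/
theorem HasExpansion.charConditions (hd : 1 < |d|) (hF : ∀ l, LocL2 (F l))
    (hG : ∀ l, LocL2 (G l)) {J : ℤ} (h : HasExpansion d J F G) : CharConditions d F G F G := by
  have hd0 := ne_zero_of_one_lt_abs hd
  have hdef := defect_eq_zero_of_levelSum hF hG hd0 (zpow_ne_zero (-J) hd0)
    (h.levelSum_add_eq hd0)
  exact charConditions_of_defect hd0 hdef ((tendsto_levelSum_iff hd hF).2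
    ((hasExpansion_iff_tendsto hd0 hF hG hdef J).1 h))

end Telescope

/-! ### Energies of test functions and polarization -/

theorem conj_mul_self_eq (z : ℂ) : conj z * z = ((‖z‖ ^ 2 : ℝ) : ℂ) := by
  rw [Complex.conj_mul']
  push_cast
  rfl

/-- The energy of one level as a real number. -/
noncomputable def levelEnergy {r : ℕ} (F : Fin r → ℝ → ℂ) (lam : ℝ) (f : ℝ → ℂ) : ℝ :=
  ∑ l, ∑' k : ℤ, ‖coef (F l) lam f k‖ ^ 2

theorem levelEnergy_nonneg {r : ℕ} (F : Fin r → ℝ → ℂ) (lam : ℝ) (f : ℝ → ℂ) :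
    0 ≤ levelEnergy F lam f :=
  Finset.sum_nonneg fun _ _ => tsum_nonneg fun _ => by positivity

theorem levelSum_self {r : ℕ} (F : Fin r → ℝ → ℂ) (lam : ℝ) (f : ℝ → ℂ) :
    levelSum F lam f f = levelEnergy F lam f := by
  simp only [levelSum, levelEnergy, conj_mul_self_eq]
  push_cast
  rfl

theorem enorm_sq_eq_ofReal (z : ℂ) : ‖z‖ₑ ^ 2 = ENNReal.ofReal (‖z‖ ^ 2) := by
  rw [ENNReal.ofReal_pow (norm_nonneg _), ofReal_norm]

theorem ofReal_levelEnergy {r : ℕ} {F : Fin r → ℝ → ℂ} (hF : ∀ l, LocL2 (F l)) {lam : ℝ}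
    (hl : lam ≠ 0) {f : ℝ → ℂ} (hf : BddSupp f) :
    ∑ l, ∑' k : ℤ, ‖pairFn f (tdm (F l) lam 0 k)‖ₑ ^ 2 =
      ENNReal.ofReal (levelEnergy F lam f) := by
  rw [levelEnergy, ENNReal.ofReal_sum_of_nonneg fun _ _ => tsum_nonneg fun _ => by positivity]
  refine Finset.sum_congr rfl fun l _ => ?_
  rw [ENNReal.ofReal_tsum_of_nonneg (fun _ => by positivity)]
  · simp only [pairFn_tdm hl, enorm_sq_eq_ofReal, RCLike.norm_conj]
  · have := summable_norm_conj_coef_mul (hF l) hf hf hl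
    simpa only [norm_mul, RCLike.norm_conj, ← sq] using this

theorem ofReal_add_tsum_eq_iff {a : ℕ → ℝ} {a₀ c : ℝ} (ha : ∀ i, 0 ≤ a i) (ha₀ : 0 ≤ a₀)
    (hc : 0 ≤ c) : (ENNReal.ofReal a₀ + ∑' i, ENNReal.ofReal (a i) = ENNReal.ofReal c) ↔
      Tendsto (fun n => a₀ + ∑ i ∈ Finset.range n, a i) atTop (𝓝 c) := by
  have h1 : Tendsto (fun n => ENNReal.ofReal (a₀ + ∑ i ∈ Finset.range n, a i)) atTop
      (𝓝 (ENNReal.ofReal a₀ + ∑' i, ENNReal.ofReal (a i))) := by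
    simp only [ENNReal.ofReal_add ha₀ (Finset.sum_nonneg fun i _ => ha i),
      ENNReal.ofReal_sum_of_nonneg fun i _ => ha i]
    exact tendsto_const_nhds.add (ENNReal.tendsto_nat_tsum _)
  constructor
  · intro h
    rw [h] at h1
    have h2 := (ENNReal.tendsto_toReal ENNReal.ofReal_ne_top).comp h1
    rw [ENNReal.toReal_ofReal hc] at h2
    refine h2.congr fun n => ?_
    exact ENNReal.toReal_ofReal (add_nonneg ha₀ (Finset.sum_nonneg fun i _ => ha i))
  · intro h
    exact tendsto_nhds_unique h1 ((ENNReal.continuous_ofReal.tendsto _).comp h)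

theorem pairFn_self {f : ℝ → ℂ} (hf : MemLp f 2) :
    pairFn f f = (((eLpNorm f 2 volume).toReal ^ 2 : ℝ) : ℂ) := by
  have h1 : inner ℂ hf.toLp hf.toLp = pairFn f f := by
    rw [L2.inner_def, pairFn]
    refine integral_congr_ae ?_
    filter_upwards [hf.coeFn_toLp] with x hx
    rw [hx, RCLike.inner_apply]
  rw [← h1, inner_self_eq_norm_sq_to_K, Lp.norm_toLp]
  push_cast
  rfl

theorem ofReal_mul_eLpNorm_sq {f : ℝ → ℂ} (hf : MemLp f 2) (c : ℝ) (hc : 0 ≤ c) :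
    ENNReal.ofReal c * eLpNorm f 2 volume ^ 2 =
      ENNReal.ofReal (c * (eLpNorm f 2 volume).toReal ^ 2) := by
  rw [ENNReal.ofReal_mul hc, ENNReal.ofReal_pow ENNReal.toReal_nonneg,
    ENNReal.ofReal_toReal hf.eLpNorm_ne_top]

theorem sum_Ico_int_add_nat {M : Type*} [AddCommMonoid M] (u : ℤ → M) (J : ℤ) (n : ℕ) :
    ∑ j ∈ Finset.Ico J (J + n), u j = ∑ i ∈ Finset.range n, u (J + i) := by
  symm
  refine Finset.sum_nbij (fun i : ℕ => J + (i : ℤ)) ?_ ?_ ?_ fun _ _ => rfl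
  · intro i hi
    simp at hi ⊢
    exact hi
  · intro a _ b _ h
    simpa using h
  · intro j hj
    simp only [Finset.coe_Ico, Set.mem_Ico] at hj
    refine ⟨(j - J).toNat, ?_, ?_⟩
    · simp
      omega
    · simp
      omega

section Energy

variable {d : ℝ} {J : ℤ} {r s : ℕ} {F : Fin r → ℝ → ℂ} {G : Fin s → ℝ → ℂ}

/-- The energy identity for a test function as convergence of the diagonal expansion. -/
theorem freqEnergy_eq_iff (hd : d ≠ 0) (hF : ∀ l, LocL2 (F l)) (hG : ∀ l, LocL2 (G l))
    (f : TestFn) : freqEnergy d J F G f = ENNReal.ofReal (2 * Real.pi) * eLpNorm f 2 volume ^ 2 ↔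
      Tendsto (fun J' : ℤ => levelSum F (d ^ (-J)) f f +
        ∑ j ∈ Finset.Ico J J', levelSum G (d ^ (-j)) f f) atTop (𝓝 (2 * Real.pi * pairFn f f)) := by
  have hf2 := TestFn.memLp_two f
  have hfb := BddSupp.of_testFn f
  rw [ofReal_mul_eLpNorm_sq hf2 _ Real.two_pi_pos.le, freqEnergy,
    ofReal_levelEnergy hF (zpow_ne_zero _ hd) hfb]
  simp only [fun j : ℤ => ofReal_levelEnergy hG (zpow_ne_zero (-j) hd) hfb]
  rw [ofReal_add_tsum_eq_iff (fun _ => levelEnergy_nonneg _ _ _) (levelEnergy_nonneg _ _ _)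
    (by positivity), ← tendsto_ofReal_iff, pairFn_self hf2]
  have h2 : Tendsto (fun n : ℤ => n + J) atTop atTop := tendsto_atTop_add_const_right _ _ tendsto_id
  have h3 : Tendsto (fun n : ℤ => n - J) atTop atTop := tendsto_atTop_add_const_right _ _ tendsto_id
  have e : ∀ n : ℕ, ((levelEnergy F (d ^ (-J)) f + ∑ i ∈ Finset.range n,
      levelEnergy G (d ^ (-(J + (i : ℤ)))) f : ℝ) : ℂ) = levelSum F (d ^ (-J)) f f +
        ∑ j ∈ Finset.Ico J (n + J), levelSum G (d ^ (-j)) f f := by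
    intro n
    simp only [add_comm (n : ℤ) J, sum_Ico_int_add_nat, levelSum_self]
    push_cast
    rfl
  have e2 : ((2 * Real.pi * (eLpNorm f 2 volume).toReal ^ 2 : ℝ) : ℂ) =
      2 * Real.pi * (((eLpNorm f 2 volume).toReal ^ 2 : ℝ) : ℂ) := by push_cast; rfl
  change Tendsto (fun n : ℕ => ((levelEnergy F (d ^ (-J)) f + ∑ i ∈ Finset.range n,
      levelEnergy G (d ^ (-(J + (i : ℤ)))) f : ℝ) : ℂ)) atTop
      (𝓝 ((2 * Real.pi * (eLpNorm f 2 volume).toReal ^ 2 : ℝ) : ℂ)) ↔ _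
  simp only [e, e2]
  rw [← tendsto_int_iff_nat (u := fun n : ℤ => levelSum F (d ^ (-J)) f f +
        ∑ j ∈ Finset.Ico J (n + J), levelSum G (d ^ (-j)) f f)]
  constructor
  · intro h
    refine (h.comp h3).congr fun n => ?_
    simp
  · exact fun h => h.comp h2

theorem integrable_coef {F f : ℝ → ℂ} (hF : MemLp F 2) (hf : MemLp f 2) {lam : ℝ} (hl : lam ≠ 0)
    (k : ℤ) : Integrable fun y : ℝ =>
      F y * conj (f (y / lam)) * Complex.exp (-(Complex.I * k * y)) := by
  have h1 : MemLp (fun y => f (y / lam)) 2 := by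
    simp only [div_eq_inv_mul]
    exact MemLp.comp_mul_left_real hf (inv_ne_zero hl)
  have h2 : Integrable fun y => F y * conj (f (y / lam)) :=
    (integrable_conj_mul h1 hF).congr (ae_of_all _ fun y => mul_comm _ _)
  refine h2.mul_bdd (c := 1) (by fun_prop) (ae_of_all _ fun t => ?_)
  rw [show -(Complex.I * k * t) = ((-(k * t) : ℝ) : ℂ) * Complex.I by push_cast; ring,
    Complex.norm_exp_ofReal_mul_I]

theorem coef_add_smul {F f g : ℝ → ℂ} (hF : MemLp F 2) (hf : MemLp f 2) (hg : MemLp g 2)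
    {lam : ℝ} (hl : lam ≠ 0) (c : ℂ) (k : ℤ) :
    coef F lam (f + c • g) k = coef F lam f k + conj c * coef F lam g k := by
  simp only [coef]
  rw [mul_left_comm, ← mul_add, ← integral_const_mul (conj c),
    ← integral_add (integrable_coef hF hf hl k) ((integrable_coef hF hg hl k).const_mul _)]
  congr 2
  ext y
  simp only [Pi.add_apply, Pi.smul_apply, smul_eq_mul, map_add, map_mul]
  ring

/-- `coef` is conjugate linear in the test function, so polarization holds for each `k`; the
summability from Parseval lets it be summed. -/
theorem levelSum_polarization (hF : ∀ l, MemLp (F l) 2) (f g : TestFn) {lam : ℝ} (hl : lam ≠ 0) :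
    levelSum F lam f g = 4⁻¹ * (levelSum F lam (f + (1 : ℂ) • g : TestFn) (f + (1 : ℂ) • g : TestFn)
      - levelSum F lam (f + (-1 : ℂ) • g : TestFn) (f + (-1 : ℂ) • g : TestFn)
      + Complex.I * (levelSum F lam (f + Complex.I • g : TestFn) (f + Complex.I • g : TestFn)
      - levelSum F lam (f + (-Complex.I) • g : TestFn) (f + (-Complex.I) • g : TestFn))) := by
  simp only [levelSum]
  rw [← Finset.sum_sub_distrib, ← Finset.sum_sub_distrib, Finset.mul_sum, ← Finset.sum_add_distrib,
    Finset.mul_sum]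
  refine Finset.sum_congr rfl fun l _ => ?_
  have hs : ∀ h : TestFn, HasSum _ _ := fun h => (Summable.of_norm (summable_norm_conj_coef_mul
    (LocL2.of_memLp (hF l)) (BddSupp.of_testFn h) (BddSupp.of_testFn h) hl)).hasSum
  have key := (((hs (f + (1 : ℂ) • g)).sub (hs (f + (-1 : ℂ) • g))).add
    (((hs (f + Complex.I • g)).sub (hs (f + (-Complex.I) • g))).mul_left Complex.I)).mul_left 4⁻¹
  rw [← key.tsum_eq]
  congr 1
  ext k
  have hc : ∀ c : ℂ, coef (F l) lam (f + c • g : TestFn) k =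
      coef (F l) lam f k + conj c * coef (F l) lam g k := fun c =>
    coef_add_smul (hF l) (TestFn.memLp_two f) (TestFn.memLp_two g) hl c k
  simp only [hc, map_add, map_mul, map_neg, Complex.conj_I, map_one]
  linear_combination ((1 / 2 : ℂ) * conj (coef (F l) lam f k) * coef (F l) lam g k -
    (1 / 2 : ℂ) * coef (F l) lam f k * conj (coef (F l) lam g k)) * Complex.I_sq

theorem pairFn_polarization (f g : TestFn) :
    pairFn f g = 4⁻¹ * (pairFn (f + (1 : ℂ) • g : TestFn) (f + (1 : ℂ) • g : TestFn)
      - pairFn (f + (-1 : ℂ) • g : TestFn) (f + (-1 : ℂ) • g : TestFn)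
      + Complex.I * (pairFn (f + Complex.I • g : TestFn) (f + Complex.I • g : TestFn)
      - pairFn (f + (-Complex.I) • g : TestFn) (f + (-Complex.I) • g : TestFn))) := by
  have hi : ∀ h : TestFn, Integrable fun x => h x * conj (h x) := fun h =>
    (integrable_conj_mul (TestFn.memLp_two h) (TestFn.memLp_two h)).congr
      (ae_of_all _ fun y => mul_comm _ _)
  have hi2 : ∀ h h' : TestFn, Integrable fun x => h x * conj (h x) - h' x * conj (h' x) :=
    fun h h' => (hi h).sub (hi h')
  simp only [pairFn]
  rw [← integral_sub (hi _) (hi _), ← integral_sub (hi _) (hi _), ← integral_const_mul,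
    ← integral_add (hi2 _ _) ((hi2 _ _).const_mul _), ← integral_const_mul]
  congr 1
  ext x
  have hc : ∀ c : ℂ, (f + c • g : TestFn) x = f x + c * g x := fun c => rfl
  simp only [hc, map_add, map_mul, map_neg, Complex.conj_I, map_one]
  linear_combination ((1 / 2 : ℂ) * (f x * conj (g x) - conj (f x) * g x)) * Complex.I_sq

/-- A tight frame identity for all test functions gives the expansion of their pairings. -/
theorem hasExpansion_of_freqEnergy (hd : d ≠ 0) (hF : ∀ l, MemLp (F l) 2)
    (hG : ∀ l, MemLp (G l) 2) (h : ∀ f : TestFn, freqEnergy d J F G f =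
      ENNReal.ofReal (2 * Real.pi) * eLpNorm f 2 volume ^ 2) : HasExpansion d J F G := by
  intro f g
  have ht := fun f : TestFn => (freqEnergy_eq_iff hd (fun l => LocL2.of_memLp (hF l))
    (fun l => LocL2.of_memLp (hG l)) f).1 (h f)
  have key := ((((ht (f + (1 : ℂ) • g)).sub (ht (f + (-1 : ℂ) • g))).add
    (((ht (f + Complex.I • g)).sub (ht (f + (-Complex.I) • g))).const_mul Complex.I)).const_mul
      (4⁻¹ : ℂ))
  have e : 2 * Real.pi * pairFn f g = _ := congrArg (2 * (Real.pi : ℂ) * ·) (pairFn_polarization f g)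
  convert! key using 1
  · ext J'
    simp only [levelSum_polarization hF f g (zpow_ne_zero _ hd),
      levelSum_polarization hG f g (zpow_ne_zero _ hd), ← Finset.mul_sum, Finset.sum_add_distrib,
      Finset.sum_sub_distrib]
    ring
  · rw [e]
    congr 1
    ring

/-! ### Square integrability of generators of dual frames -/

/-- The coefficient with `k = 0` has no modulation: it is `u` applied to a unitary dilate of `conj
f`. Undoing the dilation bounds `u` itself in the `L²` norm. -/
theorem exists_memLp_of_pairDT_le {u : Distr} {lam C : ℝ} (hl : lam ≠ 0) (hC : 0 ≤ C)
    (h : ∀ f : TestFn, ‖pairDT (u.tdm lam 0 ((0 : ℤ) : ℝ)) f‖ ^ 2 ≤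
      C * (eLpNorm f 2 volume).toReal ^ 2) : ∃ F : ℝ → ℂ, MemLp F 2 ∧ IsGivenBy u F := by
  refine exists_memLp_isGivenBy (C := Real.sqrt C) fun g => ?_
  have h1 := h (conjTest (dualTdm lam⁻¹ 0 0 (inv_ne_zero hl) g))
  have e1 : pairDT (u.tdm lam 0 ((0 : ℤ) : ℝ)) (conjTest (dualTdm lam⁻¹ 0 0 (inv_ne_zero hl) g)) =
      u g := by
    rw [pairDT, distr_tdm_apply _ _ _ _ hl, conjTest_conjTest]
    congr 1
    ext y
    rw [Int.cast_zero, dualTdm_zero_zero_apply, dualTdm_zero_zero_apply]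
    have hs : (Real.sqrt |lam| : ℂ) ≠ 0 := by
      exact_mod_cast (Real.sqrt_pos.2 (abs_pos.2 hl)).ne'
    rw [abs_inv, Real.sqrt_inv, Complex.ofReal_inv, inv_inv, mul_assoc, mul_inv_cancel₀ hs, mul_one]
    congr 1
    field_simp
  have e2 : eLpNorm (conjTest (dualTdm lam⁻¹ 0 0 (inv_ne_zero hl) g)) 2 volume =
      eLpNorm g 2 volume := by
    rw [← eLpNorm_dualTdm lam⁻¹ (inv_ne_zero hl) g]
    refine eLpNorm_congr_norm_ae (ae_of_all _ fun x => ?_)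
    rw [conjTest_apply, RCLike.norm_conj]
  rw [e1, e2] at h1
  refine le_of_sq_le_sq ?_ (by positivity)
  rwa [mul_pow, Real.sq_sqrt hC]

theorem le_of_tendsto_ofReal_mono {b : ℤ → ℝ} (hb : Monotone b) {c : ℝ}
    (h : Tendsto (fun j => (b j : ℂ)) atTop (𝓝 (c : ℂ))) (j : ℤ) : b j ≤ c :=
  hb.ge_of_tendsto (tendsto_ofReal_iff.1 h) j

end Energy

/-- For `f = g` all terms are squared moduli, so the partial sums increase to `2π ‖f‖²` and bound
every single coefficient. Nothing is known beforehand of the generators except that they are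
distributions. -/
theorem IsDualFramePair.exists_memLp {d : ℝ} {J : ℤ} {r s : ℕ} {Φ : Fin r → Distr}
    {Ψ : Fin s → Distr} (hd : d ≠ 0) (h : IsDualFramePair d J Φ Ψ Φ Ψ) :
    (∀ l, ∃ F : ℝ → ℂ, MemLp F 2 ∧ IsGivenBy (Φ l) F) ∧
      ∀ l, ∃ G : ℝ → ℂ, MemLp G 2 ∧ IsGivenBy (Ψ l) G := by
  have hdt : ∀ (u : Distr) (lam : ℝ) (f : TestFn) (k : ℤ), dualTerm lam u u f f k =
      ((‖pairDT (u.tdm lam 0 k) f‖ ^ 2 : ℝ) : ℂ) := fun u lam f k => conj_mul_self_eq _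
  let E : {n : ℕ} → (Fin n → Distr) → ℤ → TestFn → ℝ := fun U j f =>
    ∑ l, ∑' k : ℤ, ‖pairDT ((U l).tdm (d ^ (-j)) 0 k) f‖ ^ 2
  have hE0 : ∀ {n : ℕ} (U : Fin n → Distr) (j : ℤ) (f : TestFn), 0 ≤ E U j f := fun U j f =>
    Finset.sum_nonneg fun _ _ => tsum_nonneg fun _ => by positivity
  have hmono : ∀ f, Monotone fun J' : ℤ => E Φ J f + ∑ j ∈ Finset.Ico J J', E Ψ j f := by
    intro f a b hab
    have := Finset.sum_le_sum_of_subset_of_nonneg (Finset.Ico_subset_Ico_right (a := J) hab)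
      fun j _ _ => hE0 Ψ j f
    simpa using this
  have hle : ∀ (f : TestFn) (J' : ℤ), E Φ J f + ∑ j ∈ Finset.Ico J J', E Ψ j f ≤
      2 * Real.pi * (eLpNorm f 2 volume).toReal ^ 2 := by
    intro f
    refine le_of_tendsto_ofReal_mono (hmono f) ?_
    have h1 := (h f f).2.2
    rw [pairFn_self (TestFn.memLp_two f)] at h1
    convert! h1 using 1
    · ext J'
      simp only [E, hdt]
      push_cast
      rfl
    · push_cast
      rfl
  have hterm : ∀ {n : ℕ} (U : Fin n → Distr) (j : ℤ) (f : TestFn), (∀ l, Summable fun k : ℤ =>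
      ‖dualTerm (d ^ (-j)) (U l) (U l) f f k‖) → ∀ l,
      ‖pairDT ((U l).tdm (d ^ (-j)) 0 ((0 : ℤ) : ℝ)) f‖ ^ 2 ≤ E U j f := by
    intro n U j f hs l
    have h1 := hs l
    simp only [hdt, Complex.norm_real, Real.norm_of_nonneg (sq_nonneg _)] at h1
    refine (h1.le_tsum 0 fun _ _ => by positivity).trans ?_
    exact Finset.single_le_sum (f := fun l => ∑' k : ℤ, ‖pairDT ((U l).tdm (d ^ (-j)) 0 k) f‖ ^ 2)
      (fun _ _ => tsum_nonneg fun _ => by positivity) (Finset.mem_univ l)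
  constructor
  · intro l
    refine exists_memLp_of_pairDT_le (zpow_ne_zero (-J) hd) Real.two_pi_pos.le fun f => ?_
    refine (hterm Φ J f (h f f).1 l).trans ?_
    simpa using hle f J
  · intro l
    refine exists_memLp_of_pairDT_le (zpow_ne_zero (-J) hd) Real.two_pi_pos.le fun f => ?_
    -- The upper limit `J + 1` is the first for which the partial sum contains a level of `Ψ`.
    refine (hterm Ψ J f ((h f f).2.1 J le_rfl) l).trans (le_trans ?_ (hle f (J + 1)))
    rw [show J + 1 = J + ((1 : ℕ) : ℤ) by simp, sum_Ico_int_add_nat (fun j => E Ψ j f) J 1]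
    simpa using hE0 Φ J f

/-! ### Frame identities on dense subsets -/

/-- Viewing the `ℓ²` norm as an `L²` norm for the counting measure supplies Minkowski's inequality.
-/
theorem eLpNorm_two_count_sq {ι : Type*} [MeasurableSpace ι] [MeasurableSingletonClass ι]
    (g : ι → ℂ) : eLpNorm g 2 Measure.count ^ 2 = ∑' i, ‖g i‖ₑ ^ 2 := by
  have h := eLpNorm_nnreal_pow_eq_lintegral (f := g) (p := 2) (μ := Measure.count) two_ne_zero
  rw [lintegral_count] at h
  simpa using h

/-- The frame identity extends from a dense subset of a Hilbert space. -/
theorem tsum_enorm_inner_sq_eq_of_dense {ι H : Type*} [Countable ι] [NormedAddCommGroup H]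
    [InnerProductSpace ℂ H] {v : ι → H} {A : ℝ} (hA : 0 ≤ A) {D : Set H} (hD : Dense D)
    (h : ∀ f ∈ D, ∑' i, ‖inner ℂ (v i) f‖ₑ ^ 2 = ENNReal.ofReal A * ‖f‖ₑ ^ 2) (f : H) :
    ∑' i, ‖inner ℂ (v i) f‖ₑ ^ 2 = ENNReal.ofReal A * ‖f‖ₑ ^ 2 := by
  let _ : MeasurableSpace ι := ⊤
  let N : H → ℝ≥0∞ := fun f => eLpNorm (fun i => inner ℂ (v i) f) 2 Measure.count
  have hNsq : ∀ f, N f ^ 2 = ∑' i, ‖inner ℂ (v i) f‖ₑ ^ 2 := fun f => eLpNorm_two_count_sq _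
  have hRe : ∀ f : H, ENNReal.ofReal A * ‖f‖ₑ ^ 2 = ENNReal.ofReal (Real.sqrt A * ‖f‖) ^ 2 := by
    intro f
    rw [← ENNReal.ofReal_pow (by positivity), mul_pow, Real.sq_sqrt hA, ENNReal.ofReal_mul hA,
      ENNReal.ofReal_pow (norm_nonneg _), ofReal_norm]
  have hle : ∀ f, N f ≤ ENNReal.ofReal (Real.sqrt A * ‖f‖) := by
    intro f
    -- Finite partial sums are continuous in `f`, so the Bessel bound passes to the closure before
    -- the equality does.
    have h1 : ∀ s : Finset ι, ∑ i ∈ s, ‖inner ℂ (v i) f‖ₑ ^ 2 ≤ ENNReal.ofReal A * ‖f‖ₑ ^ 2 := by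
      intro s
      have hcl : IsClosed {f : H | ∑ i ∈ s, ‖inner ℂ (v i) f‖ₑ ^ 2 ≤
          ENNReal.ofReal A * ‖f‖ₑ ^ 2} := by
        refine isClosed_le ?_ ?_
        · refine continuous_finsetSum _ fun i _ => ?_
          exact (ENNReal.continuous_pow 2).comp (by fun_prop)
        · exact (ENNReal.continuous_const_mul ENNReal.ofReal_ne_top).comp
            ((ENNReal.continuous_pow 2).comp (by fun_prop))
      refine hD.induction (P := fun f : H => ∑ i ∈ s, ‖inner ℂ (v i) f‖ₑ ^ 2 ≤
          ENNReal.ofReal A * ‖f‖ₑ ^ 2) (fun g hg => ?_) hcl f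
      rw [← h g hg]
      exact ENNReal.sum_le_tsum s
    have h2 : N f ^ 2 ≤ ENNReal.ofReal (Real.sqrt A * ‖f‖) ^ 2 := by
      rw [hNsq, ← hRe, ENNReal.tsum_eq_iSup_sum]
      exact iSup_le h1
    exact (ENNReal.pow_right_strictMono two_ne_zero).le_iff_le.1 h2
  have hfin : ∀ f, N f ≠ ⊤ := fun f => ne_top_of_le_ne_top ENNReal.ofReal_ne_top (hle f)
  -- A bounded seminorm is Lipschitz, and equality of two continuous functions on a dense set is
  -- global.
  have hlip : LipschitzWith (Real.toNNReal (Real.sqrt A)) fun f => (N f).toReal := by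
    refine LipschitzWith.of_le_add_mul' _ fun f g => ?_
    have h1 : N f ≤ N g + N (f - g) := by
      have e : (fun i => inner ℂ (v i) f) =
          (fun i => inner ℂ (v i) g) + fun i => inner ℂ (v i) (f - g) := by
        ext i
        simp
      simp only [N]
      rw [e]
      exact eLpNorm_add_le (Measurable.of_discrete.aestronglyMeasurable)
        (Measurable.of_discrete.aestronglyMeasurable) one_le_two
    have h2 := ENNReal.toReal_mono (ENNReal.add_ne_top.2 ⟨hfin g, hfin (f - g)⟩) h1
    rw [ENNReal.toReal_add (hfin g) (hfin _)] at h2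
    have h3 := ENNReal.toReal_mono ENNReal.ofReal_ne_top (hle (f - g))
    rw [ENNReal.toReal_ofReal (by positivity)] at h3
    rw [dist_eq_norm]
    linarith
  have hN : (N f).toReal = Real.sqrt A * ‖f‖ := by
    refine hD.induction (P := fun f : H => (N f).toReal = Real.sqrt A * ‖f‖) (fun g hg => ?_)
      (isClosed_eq hlip.continuous (by fun_prop)) f
    have h1 : N g ^ 2 = ENNReal.ofReal (Real.sqrt A * ‖g‖) ^ 2 := by rw [hNsq, h g hg, hRe]
    rw [(ENNReal.pow_right_strictMono two_ne_zero).injective h1,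
      ENNReal.toReal_ofReal (by positivity)]
  rw [← hNsq, hRe, ← hN, ENNReal.ofReal_toReal (hfin f)]

/-! ### Systems of square integrable functions -/

theorem tdm_eq (F : ℝ → ℂ) (lam k n : ℝ) : tdm F lam k n =
    fun x : ℝ => ((Real.sqrt |lam| : ℂ) * Complex.exp (-Complex.I * n * lam * x)) *
      (fun y => F (y + -k)) (lam * x) := rfl

theorem norm_exp_modulation (a b x : ℝ) :
    ‖Complex.exp (-Complex.I * a * b * x)‖ = 1 := by
  rw [show (-Complex.I * a * b * x : ℂ) = ((-(a * b * x) : ℝ) : ℂ) * Complex.I by push_cast; ring,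
    Complex.norm_exp_ofReal_mul_I]

theorem memLp_tdm {F : ℝ → ℂ} (hF : MemLp F 2) {lam : ℝ} (hl : lam ≠ 0) (k n : ℝ) :
    MemLp (tdm F lam k n) 2 := by
  have h1 := MemLp.comp_mul_left_real (MemLp.comp_add_right_real hF (-k)) hl
  have h2 : MemLp (fun x : ℝ => (Real.sqrt |lam| : ℂ) *
      Complex.exp (-Complex.I * n * lam * x)) ⊤ := by
    refine memLp_top_of_bound (by fun_prop) (Real.sqrt |lam|) (ae_of_all _ fun x => ?_)
    rw [norm_mul, norm_exp_modulation, mul_one, Complex.norm_real,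
      Real.norm_of_nonneg (Real.sqrt_nonneg _)]
  exact h1.mul h2

theorem eLpNorm_tdm (F : ℝ → ℂ) {lam : ℝ} (hl : lam ≠ 0) (k n : ℝ) :
    eLpNorm (tdm F lam k n) 2 volume = eLpNorm F 2 volume := by
  have e : eLpNorm (tdm F lam k n) 2 volume =
      eLpNorm ((Real.sqrt |lam| : ℂ) • fun x => (fun y => F (y + -k)) (lam * x)) 2 volume := by
    refine eLpNorm_congr_norm_ae (ae_of_all _ fun x => ?_)
    rw [tdm_eq F lam k n, Pi.smul_apply, norm_mul, norm_mul, norm_smul, norm_exp_modulation,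
      mul_one]
  refine (ENNReal.pow_right_strictMono two_ne_zero).injective ?_
  rw [e, eLpNorm_const_smul, mul_pow, eLpNorm_two_comp_mul_left_sq (fun y => F (y + -k)) hl,
    eLpNorm_two_comp_add_right, ← mul_assoc, enorm_sq_eq_ofReal, Complex.norm_real,
    Real.norm_of_nonneg (Real.sqrt_nonneg _), Real.sq_sqrt (abs_nonneg _),
    ← ENNReal.ofReal_mul (abs_nonneg _), abs_inv, mul_inv_cancel₀ (abs_pos.2 hl).ne',
    ENNReal.ofReal_one, one_mul]

theorem pairFn_eq_inner {f g : ℝ → ℂ} (hf : MemLp f 2) (hg : MemLp g 2) :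
    pairFn f g = inner ℂ hg.toLp hf.toLp := by
  rw [L2.inner_def, pairFn]
  refine integral_congr_ae ?_
  filter_upwards [hf.coeFn_toLp, hg.coeFn_toLp] with x hx hy
  rw [hx, hy, RCLike.inner_apply]

theorem enorm_toLp_eq {f : ℝ → ℂ} (hf : MemLp f 2) : ‖hf.toLp‖ₑ = eLpNorm f 2 volume := by
  rw [Lp.enorm_toLp]

section System

variable {d : ℝ} {r s : ℕ} {F : Fin r → ℝ → ℂ} {G : Fin s → ℝ → ℂ}

/-- The nonhomogeneous system as a family in `L²`. -/
noncomputable def freqSystem (hd : d ≠ 0) (J : ℤ) (hF : ∀ l, MemLp (F l) 2)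
    (hG : ∀ l, MemLp (G l) 2) :
    (Fin r × ℤ) ⊕ (ℕ × Fin s × ℤ) → Lp ℂ 2 (volume : Measure ℝ)
  | Sum.inl (l, k) => (memLp_tdm (hF l) (zpow_ne_zero (-J) hd) 0 k).toLp
  | Sum.inr (i, l, k) => (memLp_tdm (hG l) (zpow_ne_zero (-(J + (i : ℤ))) hd) 0 k).toLp

theorem freqEnergy_eq_tsum (hd : d ≠ 0) (J : ℤ) (hF : ∀ l, MemLp (F l) 2)
    (hG : ∀ l, MemLp (G l) 2) {f : ℝ → ℂ} (hf : MemLp f 2) :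
    freqEnergy d J F G f = ∑' i, ‖inner ℂ (freqSystem hd J hF hG i) hf.toLp‖ₑ ^ 2 := by
  have h := ((ENNReal.summable.hasSum).sum (ENNReal.summable.hasSum) :
    HasSum (fun i => ‖inner ℂ (freqSystem hd J hF hG i) hf.toLp‖ₑ ^ 2) _)
  rw [h.tsum_eq, freqEnergy]
  congr 1
  · rw [ENNReal.tsum_prod', tsum_fintype]
    refine Finset.sum_congr rfl fun l _ => tsum_congr fun k => ?_
    rw [pairFn_eq_inner hf (memLp_tdm (hF l) (zpow_ne_zero (-J) hd) 0 k)]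
    rfl
  · rw [ENNReal.tsum_prod']
    refine tsum_congr fun i => ?_
    rw [ENNReal.tsum_prod', tsum_fintype]
    refine Finset.sum_congr rfl fun l _ => tsum_congr fun k => ?_
    rw [pairFn_eq_inner hf (memLp_tdm (hG l) (zpow_ne_zero (-(J + (i : ℤ))) hd) 0 k)]
    rfl

/-- The tight frame identity extends from test functions to `L²`. -/
theorem freqEnergy_eq_of_testFn (hd : d ≠ 0) {J : ℤ} (hF : ∀ l, MemLp (F l) 2)
    (hG : ∀ l, MemLp (G l) 2) (h : ∀ f : TestFn, freqEnergy d J F G f =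
      ENNReal.ofReal (2 * Real.pi) * eLpNorm f 2 volume ^ 2) {f : ℝ → ℂ} (hf : MemLp f 2) :
    freqEnergy d J F G f = ENNReal.ofReal (2 * Real.pi) * eLpNorm f 2 volume ^ 2 := by
  rw [freqEnergy_eq_tsum hd J hF hG hf, ← enorm_toLp_eq hf]
  refine tsum_enorm_inner_sq_eq_of_dense Real.two_pi_pos.le denseRange_testToLp ?_ _
  rintro _ ⟨g, rfl⟩
  have := h g
  rw [freqEnergy_eq_tsum hd J hF hG (TestFn.memLp_two g), ← enorm_toLp_eq (TestFn.memLp_two g)]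
    at this
  exact this

/-- The homogeneous system as a family in `L²`. -/
noncomputable def freqHomSystem (hd : d ≠ 0) (hG : ∀ l, MemLp (G l) 2) :
    ℤ × Fin s × ℤ → Lp ℂ 2 (volume : Measure ℝ) :=
  fun i => (memLp_tdm (hG i.2.1) (zpow_ne_zero i.1 hd) 0 i.2.2).toLp

theorem freqHomEnergy_eq_tsum (hd : d ≠ 0) (hG : ∀ l, MemLp (G l) 2) {f : ℝ → ℂ}
    (hf : MemLp f 2) :
    freqHomEnergy d G f = ∑' i, ‖inner ℂ (freqHomSystem hd hG i) hf.toLp‖ₑ ^ 2 := by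
  rw [ENNReal.tsum_prod', freqHomEnergy]
  refine tsum_congr fun j => ?_
  rw [ENNReal.tsum_prod', tsum_fintype]
  refine Finset.sum_congr rfl fun l _ => tsum_congr fun k => ?_
  rw [pairFn_eq_inner hf (memLp_tdm (hG l) (zpow_ne_zero j hd) 0 k)]
  rfl

theorem freqEnergy_of_hasExpansion (hd : d ≠ 0) {J : ℤ} (hF : ∀ l, MemLp (F l) 2)
    (hG : ∀ l, MemLp (G l) 2) (h : HasExpansion d J F G) {f : ℝ → ℂ} (hf : MemLp f 2) :
    freqEnergy d J F G f = ENNReal.ofReal (2 * Real.pi) * eLpNorm f 2 volume ^ 2 :=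
  freqEnergy_eq_of_testFn hd hF hG (fun g => (freqEnergy_eq_iff hd
    (fun l => LocL2.of_memLp (hF l)) (fun l => LocL2.of_memLp (hG l)) g).2 (h g g)) hf

end System

/-! ### Equivalence of the frame properties in the frequency domain -/

section Equivalence

variable {d : ℝ} {J : ℤ} {r s : ℕ} {Φ : Fin r → Distr} {Ψ : Fin s → Distr}

theorem IsFreqTightFrame.isDualFramePair (hd : d ≠ 0) (h : IsFreqTightFrame d J Φ Ψ) :
    IsDualFramePair d J Φ Ψ Φ Ψ := by
  obtain ⟨F, G, hF, hG, hE⟩ := h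
  rw [isDualFramePair_iff_hasExpansion hd (fun l => LocL2.of_memLp (hF l).1)
    (fun l => LocL2.of_memLp (hG l).1) (fun l => (hF l).2) (fun l => (hG l).2)]
  exact hasExpansion_of_freqEnergy hd (fun l => (hF l).1) (fun l => (hG l).1)
    fun f => hE f (TestFn.memLp_two f)

theorem IsDualFramePair.isFreqTightFrame (hd : d ≠ 0) (h : IsDualFramePair d J Φ Ψ Φ Ψ) :
    IsFreqTightFrame d J Φ Ψ := by
  obtain ⟨hF, hG⟩ := h.exists_memLp hd
  choose F hF using hF
  choose G hG using hG
  refine ⟨F, G, hF, hG, fun f hf => ?_⟩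
  refine freqEnergy_of_hasExpansion hd (fun l => (hF l).1) (fun l => (hG l).1) ?_ hf
  exact (isDualFramePair_iff_hasExpansion hd (fun l => LocL2.of_memLp (hF l).1)
    (fun l => LocL2.of_memLp (hG l).1) (fun l => (hF l).2) (fun l => (hG l).2) J).1 h

theorem IsDualFramePair.satisfiesCharConditions (hd : 1 < |d|)
    (h : IsDualFramePair d J Φ Ψ Φ Ψ) : SatisfiesCharConditions d Φ Ψ := by
  have hd0 := ne_zero_of_one_lt_abs hd
  obtain ⟨hF, hG⟩ := h.exists_memLp hd0
  choose F hF using hF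
  choose G hG using hG
  have hF' := fun l => LocL2.of_memLp (hF l).1
  have hG' := fun l => LocL2.of_memLp (hG l).1
  exact ⟨F, G, fun l => ⟨hF' l, (hF l).2⟩, fun l => ⟨hG' l, (hG l).2⟩,
    ((isDualFramePair_iff_hasExpansion hd0 hF' hG' (fun l => (hF l).2) (fun l => (hG l).2) J).1
      h).charConditions hd hF' hG'⟩

theorem SatisfiesCharConditions.isDualFramePair (hd : 1 < |d|)
    (h : SatisfiesCharConditions d Φ Ψ) (J : ℤ) : IsDualFramePair d J Φ Ψ Φ Ψ := by
  obtain ⟨F, G, hF, hG, hc⟩ := h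
  have hF' := fun l => (hF l).1
  have hG' := fun l => (hG l).1
  exact (isDualFramePair_iff_hasExpansion (ne_zero_of_one_lt_abs hd) hF' hG' (fun l => (hF l).2)
    (fun l => (hG l).2) J).2 (hc.hasExpansion hd hF' hG' J)

end Equivalence

/-! ### Decay of the coarse levels -/

theorem integrable_norm_sq {H : ℝ → ℂ} (hH : MemLp H 2) : Integrable fun t => ‖H t‖ ^ 2 :=
  hH.integrable_norm_pow two_ne_zero

/-- Pointwise `ab ≤ (a² + b²)/2`, with translation invariance of the integral. -/
theorem norm_integral_conj_mul_shift_le {H : ℝ → ℂ} (hH : MemLp H 2) (c : ℝ) :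
    ‖∫ t, conj (H t) * H (t + c)‖ ≤ ∫ t, ‖H t‖ ^ 2 := by
  have h1 := integrable_norm_sq hH
  have h2 : Integrable fun t => ‖H (t + c)‖ ^ 2 := h1.comp_add_right c
  have h3 : ∫ t, ‖H (t + c)‖ ^ 2 = ∫ t, ‖H t‖ ^ 2 :=
    integral_add_right_eq_self (fun t => ‖H t‖ ^ 2) c
  calc ‖∫ t, conj (H t) * H (t + c)‖ ≤ ∫ t, 2⁻¹ * (‖H t‖ ^ 2 + ‖H (t + c)‖ ^ 2) := by
        refine norm_integral_le_of_norm_le ((h1.add h2).const_mul _) (ae_of_all _ fun t => ?_)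
        rw [norm_mul, RCLike.norm_conj]
        nlinarith [sq_nonneg (‖H t‖ - ‖H (t + c)‖)]
    _ = ∫ t, ‖H t‖ ^ 2 := by
        rw [integral_const_mul, integral_add h1 h2, h3]
        ring

/-- In Parseval's identity only the `4M + 1` shifts with `|n| ≤ 2M` can make the supports meet. -/
theorem tsum_norm_fourierInt_sq_le {H : ℝ → ℂ} {M : ℕ} (hH : MemLp H 2)
    (hHs : ∀ x, x ∉ Set.Ioc (-(M : ℝ)) M → H x = 0) :
    ∑' k : ℤ, ‖fourierInt H k‖ ^ 2 ≤ (4 * M + 1) * ∫ t, ‖H t‖ ^ 2 := by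
  have h1 := (hasSum_conj_fourierInt_mul hH hH hHs hHs).tsum_eq
  have h2 : ∑' n : ℤ, ∫ t, conj (H t) * H (t + n) =
      ∑ n ∈ Finset.Icc (-(2 * M : ℤ)) (2 * M), ∫ t, conj (H t) * H (t + n) := by
    refine tsum_eq_sum fun n hn => integral_eq_zero_of_ae (ae_of_all _ fun t => ?_)
    simp only [Pi.zero_apply]
    by_cases ht : t ∈ Set.Ioc (-(M : ℝ)) M
    · rw [hHs (t + n), mul_zero]
      intro ht2
      rw [Finset.mem_Icc] at hn
      refine hn ⟨?_, ?_⟩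
      · have : (-(2 * M : ℝ)) ≤ n := by linarith [ht.2, ht2.1]
        exact_mod_cast this
      · have : (n : ℝ) ≤ 2 * M := by linarith [ht.1, ht2.2]
        exact_mod_cast this
    · rw [hHs t ht]
      simp
  simp only [conj_mul_self_eq] at h1
  rw [← Complex.ofReal_tsum, h2] at h1
  have h3 : ∑' k : ℤ, ‖fourierInt H k‖ ^ 2 = ‖((∑' k : ℤ, ‖fourierInt H k‖ ^ 2 : ℝ) : ℂ)‖ := by
    rw [Complex.norm_real, Real.norm_of_nonneg (tsum_nonneg fun _ => by positivity)]
  rw [h3, h1]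
  refine (norm_sum_le_of_le _ fun (n : ℤ) _ => norm_integral_conj_mul_shift_le hH (n : ℝ)).trans ?_
  rw [Finset.sum_const, nsmul_eq_mul, Int.card_Icc]
  have : (((2 * M + 1 - -(2 * M) : ℤ).toNat : ℕ) : ℝ) = 4 * M + 1 := by
    have : (2 * M + 1 - -(2 * M) : ℤ).toNat = 4 * M + 1 := by omega
    rw [this]
    push_cast
    rfl
  rw [this]

/-- The number of overlapping shifts grows like `|lam|`, which the normalization `|lam|⁻¹`
compensates. As `f` vanishes near the origin, only the tail of `F` enters. -/
theorem tsum_norm_coef_sq_le {F f : ℝ → ℂ} {lam ε R C : ℝ} (hF : MemLp F 2) (hf : BddSupp f)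
    (hC : ∀ᵐ x, ‖f x‖ ≤ C) (hR0 : 0 ≤ R) (hR : ∀ x, R < |x| → f x = 0)
    (hε : ∀ x, |x| < ε → f x = 0) (hl : 1 ≤ |lam|) :
    ∑' k : ℤ, ‖coef F lam f k‖ ^ 2 ≤
      (2 * Real.pi * (4 * R + 9) * C ^ 2) * ∫ y in {y | ε * |lam| ≤ |y|}, ‖F y‖ ^ 2 := by
  have hlp : 0 < |lam| := by linarith
  have hl0 : lam ≠ 0 := abs_pos.1 hlp
  have hp : (0 : ℝ) < 2 * Real.pi := Real.two_pi_pos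
  set H : ℝ → ℂ := fun t => F (2 * Real.pi * t) * conj (f (2 * Real.pi * t / lam)) with hHdef
  have hH : MemLp H 2 := MemLp.comp_mul_left_real
    ((LocL2.of_memLp hF).memLp_mul_conj hf hl0) hp.ne'
  set M := ⌈R * |lam|⌉₊ + 1 with hM
  have hM1 : R * |lam| < M := by
    rw [hM]
    push_cast
    linarith [Nat.le_ceil (R * |lam|)]
  have hM2 : (M : ℝ) ≤ R * |lam| + 2 := by
    rw [hM]
    push_cast
    linarith [Nat.ceil_lt_add_one (show 0 ≤ R * |lam| by positivity)]
  have hHs : ∀ x, x ∉ Set.Ioc (-(M : ℝ)) M → H x = 0 := by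
    intro x hx
    have hx' : (M : ℝ) ≤ |x| := by
      by_contra h
      push Not at h
      exact hx ⟨(abs_lt.1 h).1, (abs_lt.1 h).2.le⟩
    simp only [hHdef]
    rw [hR, map_zero, mul_zero]
    rw [abs_div, lt_div_iff₀ hlp, abs_mul, abs_of_pos hp]
    nlinarith [Real.pi_gt_three, abs_nonneg x]
  have h1 := tsum_norm_fourierInt_sq_le hH hHs
  have h2 : ∀ k, ‖coef F lam f k‖ ^ 2 = |lam|⁻¹ * (2 * Real.pi) ^ 2 * ‖fourierInt H k‖ ^ 2 := by
    intro k
    rw [coef_eq_fourierInt, norm_mul, norm_mul, norm_inv, Complex.norm_real,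
      Real.norm_of_nonneg (Real.sqrt_nonneg _), mul_pow, mul_pow, inv_pow,
      Real.sq_sqrt (abs_nonneg _), ← mul_assoc]
    congr 2
    rw [show (2 * Real.pi : ℂ) = ((2 * Real.pi : ℝ) : ℂ) by push_cast; rfl, Complex.norm_real,
      Real.norm_of_nonneg hp.le]
  set T := ∫ y in {y | ε * |lam| ≤ |y|}, ‖F y‖ ^ 2 with hT
  have hms : MeasurableSet {y : ℝ | ε * |lam| ≤ |y|} :=
    measurableSet_le measurable_const (by fun_prop)
  have hT0 : 0 ≤ T := integral_nonneg fun _ => by positivity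
  have h3 : ∫ t, ‖H t‖ ^ 2 ≤ (2 * Real.pi)⁻¹ * (C ^ 2 * T) := by
    have e := Measure.integral_comp_mul_left (fun y => ‖F y * conj (f (y / lam))‖ ^ 2)
      (2 * Real.pi)
    rw [abs_of_pos (inv_pos.2 hp), smul_eq_mul] at e
    rw [hHdef, e]
    refine mul_le_mul_of_nonneg_left ?_ (by positivity)
    rw [hT, ← integral_indicator hms, ← integral_const_mul]
    refine integral_mono_ae (integrable_norm_sq ((LocL2.of_memLp hF).memLp_mul_conj hf hl0))
      (((integrable_norm_sq hF).indicator hms).const_mul _) ?_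
    filter_upwards [ae_comp_mul_left hC (inv_ne_zero hl0)] with y hy
    by_cases hmem : y ∈ {y : ℝ | ε * |lam| ≤ |y|}
    · rw [Set.indicator_of_mem hmem, norm_mul, RCLike.norm_conj, mul_pow, mul_comm,
        div_eq_inv_mul]
      gcongr
    · rw [Set.indicator_of_notMem hmem, hε (y / lam)]
      · simp
      · rw [abs_div, div_lt_iff₀ hlp]
        exact lt_of_not_ge hmem
  simp only [h2]
  rw [tsum_mul_left]
  -- From `M ≤ R|lam| + 2` one gets `4M + 1 ≤ 4R|lam| + 9`, and `1 ≤ |lam|` absorbs the 9.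
  have h4 : |lam|⁻¹ * (4 * M + 1) ≤ 4 * R + 9 := by
    rw [inv_mul_le_iff₀ hlp]
    nlinarith
  calc |lam|⁻¹ * (2 * Real.pi) ^ 2 * ∑' k : ℤ, ‖fourierInt H k‖ ^ 2
      ≤ |lam|⁻¹ * (2 * Real.pi) ^ 2 * ((4 * M + 1) * ((2 * Real.pi)⁻¹ * (C ^ 2 * T))) := by
        refine mul_le_mul_of_nonneg_left (h1.trans ?_) (by positivity)
        exact mul_le_mul_of_nonneg_left h3 (by positivity)
    _ = (2 * Real.pi) * (|lam|⁻¹ * (4 * M + 1)) * (C ^ 2 * T) := by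
        field_simp
    _ ≤ (2 * Real.pi) * (4 * R + 9) * (C ^ 2 * T) := by
        gcongr
    _ = _ := by ring

theorem tendsto_tail_integral {F : ℝ → ℂ} (hF : MemLp F 2) {d ε : ℝ} (hd : 1 < |d|)
    (hε : 0 < ε) : Tendsto (fun n : ℕ => ∫ y in {y | ε * |d ^ n| ≤ |y|}, ‖F y‖ ^ 2) atTop
      (𝓝 0) := by
  have h := tendsto_setIntegral_of_antitone (μ := volume) (f := fun y => ‖F y‖ ^ 2)
    (s := fun n : ℕ => {y : ℝ | ε * |d ^ n| ≤ |y|})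
    (fun n => measurableSet_le measurable_const (by fun_prop))
    (fun m n hmn y hy => le_trans (by
      simp only [abs_pow]
      gcongr
      exact hd.le) (show ε * |d ^ n| ≤ |y| from hy))
    ⟨0, (integrable_norm_sq hF).integrableOn⟩
  have he : ⋂ n : ℕ, {y : ℝ | ε * |d ^ n| ≤ |y|} = ∅ := by
    refine Set.eq_empty_of_forall_notMem fun y hy => ?_
    obtain ⟨n, hn⟩ := pow_unbounded_of_one_lt (|y| / ε) hd
    have := Set.mem_iInter.1 hy n
    rw [div_lt_iff₀ hε] at hn
    simp only [Set.mem_ofPred_eq, abs_pow] at this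
    linarith
  rwa [he, setIntegral_empty] at h

/-- The energy of the coarse levels vanishes in the limit for functions supported away from
the origin. -/
theorem tendsto_levelEnergy_zero {r : ℕ} {F : Fin r → ℝ → ℂ} (hF : ∀ l, MemLp (F l) 2)
    {d : ℝ} (hd : 1 < |d|) {f : ℝ → ℂ} (hf : BddSupp f) {ε : ℝ} (hε0 : 0 < ε)
    (hε : ∀ x, |x| < ε → f x = 0) :
    Tendsto (fun n : ℕ => levelEnergy F (d ^ n) f) atTop (𝓝 0) := by
  obtain ⟨R, hR0, hR, -⟩ := hf.exists_common hf
  have hC : ∀ᵐ x, ‖f x‖ ≤ (eLpNormEssSup f volume).toReal := by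
    have h1 := hf.1.2
    rw [eLpNorm_exponent_top] at h1
    filter_upwards [enorm_ae_le_eLpNormEssSup f volume] with x hx
    rw [← toReal_enorm]
    exact ENNReal.toReal_mono h1.ne hx
  set C := (eLpNormEssSup f volume).toReal
  have hup : Tendsto (fun n : ℕ => ∑ l, (2 * Real.pi * (4 * R + 9) * C ^ 2) *
      ∫ y in {y | ε * |d ^ n| ≤ |y|}, ‖F l y‖ ^ 2) atTop (𝓝 0) := by
    have := tendsto_finsetSum Finset.univ fun (l : Fin r) _ =>
      (tendsto_tail_integral (hF l) hd hε0).const_mul (2 * Real.pi * (4 * R + 9) * C ^ 2)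
    simpa using this
  refine squeeze_zero (fun n => levelEnergy_nonneg _ _ _) (fun n => ?_) hup
  refine Finset.sum_le_sum fun l _ => ?_
  refine tsum_norm_coef_sq_le (hF l) hf hC hR0.le hR hε ?_
  rw [abs_pow]
  exact one_le_pow₀ hd.le

/-! ### The homogeneous system -/

/-- The square integrable functions that are bounded with bounded support away from the
origin. -/
def awayFromZero : Set (Lp ℂ 2 (volume : Measure ℝ)) :=
  {f | ∃ (g : ℝ → ℂ) (hg : BddSupp g) (ε : ℝ), 0 < ε ∧ (∀ x, |x| < ε → g x = 0) ∧
    f = hg.memLp_two.toLp}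

/-- Cut a small ball around the origin out of a test function; absolute continuity of the integral
makes the `L²` error small. -/
theorem dense_awayFromZero : Dense awayFromZero := by
  rw [← dense_closure]
  refine denseRange_testToLp.mono ?_
  rintro _ ⟨g, rfl⟩
  rw [Metric.mem_closure_iff]
  intro ε hε
  obtain ⟨δ, hδ, h⟩ := MemLp.eLpNorm_indicator_le one_le_two (by norm_num)
    (TestFn.memLp_two g) (half_pos hε)
  set S : Set ℝ := Metric.ball 0 (δ / 2) with hS
  have hmS : MeasurableSet S := measurableSet_ball
  have h1 := h S hmS (by rw [hS, Real.volume_ball]; apply le_of_eq; congr 1; ring)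
  have hb : BddSupp (Sᶜ.indicator g) := by
    refine ⟨(BddSupp.of_testFn g).1.indicator hmS.compl, ?_⟩
    obtain ⟨R, hR⟩ := (BddSupp.of_testFn g).2
    refine ⟨R, fun x hx => ?_⟩
    by_cases hxS : x ∈ Sᶜ
    · rw [Set.indicator_of_mem hxS, hR x hx]
    · rw [Set.indicator_of_notMem hxS]
  refine ⟨hb.memLp_two.toLp, ⟨_, hb, δ / 2, half_pos hδ, fun x hx => ?_, rfl⟩, ?_⟩
  · rw [Set.indicator_of_notMem]
    simp only [Set.mem_compl_iff, not_not, hS, Metric.mem_ball, Real.dist_eq, sub_zero]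
    exact hx
  · have e : testToLp g - hb.memLp_two.toLp =
        ((TestFn.memLp_two g).sub hb.memLp_two).toLp := rfl
    rw [dist_eq_norm, e, Lp.norm_toLp]
    have e2 : (g : ℝ → ℂ) - Sᶜ.indicator g = S.indicator g := by
      rw [Set.indicator_compl, sub_sub_cancel]
    rw [e2]
    refine lt_of_le_of_lt (ENNReal.toReal_mono ENNReal.ofReal_ne_top h1) ?_
    rw [ENNReal.toReal_ofReal (half_pos hε).le]
    exact half_lt_self hε

/-- Any finite set of integers lies in one of the tails, which gives `≤`; letting `n → ∞` in `A ≤ a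
n + ∑' j, e j` gives `≥`. -/
theorem tsum_int_eq_of_tail {e : ℤ → ℝ≥0∞} {a : ℕ → ℝ≥0∞} {A : ℝ≥0∞}
    (ha : Tendsto a atTop (𝓝 0)) (h : ∀ n : ℕ, a n + ∑' i : ℕ, e (-(n : ℤ) + i) = A) :
    ∑' j, e j = A := by
  have hinj : ∀ n : ℕ, Function.Injective fun i : ℕ => -(n : ℤ) + i := fun n a b hab => by
    simpa using hab
  apply le_antisymm
  · rw [ENNReal.tsum_eq_iSup_sum]
    refine iSup_le fun s => ?_
    obtain ⟨n, hn⟩ : ∃ n : ℕ, ∀ j ∈ s, -(n : ℤ) ≤ j := by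
      obtain ⟨b, hb⟩ := s.bddBelow
      refine ⟨b.natAbs, fun j hj => ?_⟩
      have := hb hj
      omega
    rw [← h n]
    refine le_trans ?_ le_add_self
    have hs : ∑ i ∈ s.image fun j : ℤ => (j + n).toNat, e (-(n : ℤ) + i) = ∑ j ∈ s, e j := by
      rw [Finset.sum_image fun i hi j hj hij => by
        have := hn i hi
        have := hn j hj
        omega]
      refine Finset.sum_congr rfl fun j hj => congrArg e ?_
      have := hn j hj
      omega
    rw [← hs]
    exact ENNReal.sum_le_tsum _
  · have h2 : Tendsto (fun n => a n + ∑' j, e j) atTop (𝓝 (0 + ∑' j, e j)) :=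
      ha.add tendsto_const_nhds
    rw [zero_add] at h2
    refine ge_of_tendsto' h2 fun n => ?_
    rw [← h n]
    gcongr
    exact ENNReal.tsum_comp_le_tsum_of_injective (hinj n) e

/-- The energy identity holds at every level, in particular at `-n`, where the `Φ` part tends to 0
on a dense set. -/
theorem IsFreqTightFrame.isFreqHomTightFrame {d : ℝ} (hd : 1 < |d|) {J : ℤ} {r s : ℕ}
    {Φ : Fin r → Distr} {Ψ : Fin s → Distr} (h : IsFreqTightFrame d J Φ Ψ) :
    IsFreqHomTightFrame d Ψ := by
  have hd0 := ne_zero_of_one_lt_abs hd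
  obtain ⟨F, G, hF, hG, hE⟩ := h
  have hF1 := fun l => (hF l).1
  have hG1 := fun l => (hG l).1
  have hF' := fun l => LocL2.of_memLp (hF l).1
  have hG' := fun l => LocL2.of_memLp (hG l).1
  have hexp : ∀ J, HasExpansion d J F G := ((hasExpansion_of_freqEnergy hd0 hF1 hG1
    fun f => hE f (TestFn.memLp_two f)).charConditions hd hF' hG').hasExpansion hd hF' hG'
  refine ⟨G, hG, fun f hf => ?_⟩
  rw [freqHomEnergy_eq_tsum hd0 hG1 hf, ← enorm_toLp_eq hf]
  refine tsum_enorm_inner_sq_eq_of_dense Real.two_pi_pos.le dense_awayFromZero ?_ _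
  rintro _ ⟨g, hg, ε, hε0, hε, rfl⟩
  rw [← freqHomEnergy_eq_tsum hd0 hG1 hg.memLp_two, enorm_toLp_eq hg.memLp_two]
  have ha : Tendsto (fun n : ℕ => ENNReal.ofReal (levelEnergy F (d ^ n) g)) atTop (𝓝 0) := by
    have := (ENNReal.continuous_ofReal.tendsto _).comp (tendsto_levelEnergy_zero hF1 hd hg hε0 hε)
    rwa [ENNReal.ofReal_zero] at this
  have key := tsum_int_eq_of_tail
    (e := fun j => ∑ l, ∑' k : ℤ, ‖pairFn g (tdm (G l) (d ^ (-j)) 0 k)‖ₑ ^ 2) ha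
    (A := ENNReal.ofReal (2 * Real.pi) * eLpNorm g 2 volume ^ 2) fun n => by
      rw [← freqEnergy_of_hasExpansion hd0 hF1 hG1 (hexp (-n)) hg.memLp_two, freqEnergy,
        ofReal_levelEnergy hF' (zpow_ne_zero _ hd0) hg, neg_neg, zpow_natCast]
  rw [← key, freqHomEnergy]
  exact ((Equiv.neg ℤ).tsum_eq
    fun j => ∑ l, ∑' k : ℤ, ‖pairFn g (tdm (G l) (d ^ j) 0 k)‖ₑ ^ 2).symm

/-! ### The Fourier transform of dilated and translated functions -/

theorem ae_comp_affine {p : ℝ → Prop} (h : ∀ᵐ x : ℝ, p x) {a : ℝ} (ha : a ≠ 0) (b : ℝ) :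
    ∀ᵐ x : ℝ, p (a * x - b) := by
  have h1 : ∀ᵐ x : ℝ, p (x - b) :=
    (measurePreserving_sub_right volume b).quasiMeasurePreserving.ae h
  exact ae_comp_mul_left h1 ha

theorem tdm_congr_ae {f g : ℝ → ℂ} (h : f =ᵐ[volume] g) {lam : ℝ} (hl : lam ≠ 0) (k n : ℝ) :
    tdm f lam k n =ᵐ[volume] tdm g lam k n := by
  filter_upwards [ae_comp_affine h hl k] with x hx
  rw [tdm, tdm, hx]

theorem tdm_sub (f g : ℝ → ℂ) (lam k n : ℝ) :
    tdm (f - g) lam k n = tdm f lam k n - tdm g lam k n := by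
  ext x
  simp only [tdm, Pi.sub_apply]
  ring

/-- Dilation, translation and modulation on `L²`. -/
noncomputable def tdmLp (lam k n : ℝ) (hl : lam ≠ 0) (f : Lp ℂ 2 (volume : Measure ℝ)) :
    Lp ℂ 2 (volume : Measure ℝ) :=
  (memLp_tdm (Lp.memLp f) hl k n).toLp

theorem coeFn_tdmLp (lam k n : ℝ) (hl : lam ≠ 0) (f : Lp ℂ 2 (volume : Measure ℝ)) :
    tdmLp lam k n hl f =ᵐ[volume] tdm f lam k n := MemLp.coeFn_toLp _

theorem isometry_tdmLp (lam k n : ℝ) (hl : lam ≠ 0) : Isometry (tdmLp lam k n hl) := by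
  refine Isometry.of_dist_eq fun f g => ?_
  rw [Lp.dist_def, Lp.dist_def]
  congr 1
  rw [← eLpNorm_tdm (f - g : ℝ → ℂ) hl k n, tdm_sub]
  exact eLpNorm_congr_ae ((coeFn_tdmLp lam k n hl f).sub (coeFn_tdmLp lam k n hl g))

/-- A dilated and translated Schwartz function. -/
noncomputable def tdmSchwartz (lam k : ℝ) (hl : lam ≠ 0) (S : SchwartzMap ℝ ℂ) :
    SchwartzMap ℝ ℂ :=
  (Real.sqrt |lam| : ℂ) • SchwartzMap.compCLMOfAntilipschitz ℂ (g := fun x : ℝ => lam * x - k)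
    (K := (⟨|lam|⁻¹, by positivity⟩ : NNReal)) (by fun_prop)
    (AntilipschitzWith.of_le_mul_dist fun x y => by
      change dist x y ≤ |lam|⁻¹ * dist (lam * x - k) (lam * y - k)
      rw [dist_sub_right, Real.dist_eq, Real.dist_eq, ← mul_sub, abs_mul,
        inv_mul_cancel_left₀ (abs_pos.2 hl).ne']) S

theorem tdmSchwartz_apply (lam k : ℝ) (hl : lam ≠ 0) (S : SchwartzMap ℝ ℂ) (x : ℝ) :
    tdmSchwartz lam k hl S x = tdm S lam k 0 x := by
  change (Real.sqrt |lam| : ℂ) * S (lam * x - k) = _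
  simp [tdm]

/-- Substitute `z = lam * v - k`: translation becomes modulation, by `2πk` because of the kernel
`exp (-2π i x ξ)`. -/
theorem fourier_tdmSchwartz (lam k : ℝ) (hl : lam ≠ 0) (S : SchwartzMap ℝ ℂ) (ξ : ℝ) :
    (𝓕 (tdmSchwartz lam k hl S) : SchwartzMap ℝ ℂ) ξ =
      tdm (𝓕 S : SchwartzMap ℝ ℂ) lam⁻¹ 0 (2 * Real.pi * k) ξ := by
  have hlp := abs_pos.2 hl
  have h1 := Measure.integral_comp_mul_left (fun y : ℝ =>
    (fun z => Complex.exp (((-2 * Real.pi * ((z + k) / lam) * ξ : ℝ) : ℂ) * Complex.I) * S z)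
      (y - k)) lam
  rw [integral_sub_right_eq_self (fun z : ℝ =>
    Complex.exp (((-2 * Real.pi * ((z + k) / lam) * ξ : ℝ) : ℂ) * Complex.I) * S z) k] at h1
  rw [SchwartzMap.fourier_coe, Real.fourier_real_eq_integral_exp_smul, tdm, SchwartzMap.fourier_coe,
    Real.fourier_real_eq_integral_exp_smul]
  have e1 : ∫ v : ℝ, Complex.exp (((-2 * Real.pi * v * ξ : ℝ) : ℂ) * Complex.I) •
      tdmSchwartz lam k hl S v = (Real.sqrt |lam| : ℂ) * ∫ x : ℝ,
        Complex.exp (((-2 * Real.pi * ((lam * x - k + k) / lam) * ξ : ℝ) : ℂ) * Complex.I) *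
          S (lam * x - k) := by
    rw [← integral_const_mul]
    refine integral_congr_ae (ae_of_all _ fun x => ?_)
    simp only [tdmSchwartz_apply, tdm, sub_add_cancel, mul_div_cancel_left₀ _ hl, smul_eq_mul]
    simp only [Complex.ofReal_zero, mul_zero, zero_mul, Complex.exp_zero]
    ring
  rw [e1, h1, Complex.real_smul, ← integral_const_mul, ← integral_const_mul, ← integral_const_mul]
  refine integral_congr_ae (ae_of_all _ fun z => ?_)
  simp only [smul_eq_mul, sub_zero]
  have e2 : (Real.sqrt |lam| : ℂ) * ((|lam⁻¹| : ℝ) : ℂ) = (Real.sqrt |lam⁻¹| : ℂ) := by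
    rw [← Complex.ofReal_mul, abs_inv, Real.sqrt_inv]
    congr 1
    have hs := (Real.sqrt_pos.2 hlp).ne'
    nth_rewrite 2 [← Real.mul_self_sqrt (abs_nonneg lam)]
    field_simp
  rw [← e2]
  have e3 : Complex.exp (((-2 * Real.pi * ((z + k) / lam) * ξ : ℝ) : ℂ) * Complex.I) =
      Complex.exp (-Complex.I * ((2 * Real.pi * k : ℝ) : ℂ) * ((lam⁻¹ : ℝ) : ℂ) * ξ) *
        Complex.exp (((-2 * Real.pi * z * (lam⁻¹ * ξ) : ℝ) : ℂ) * Complex.I) := by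
    rw [← Complex.exp_add]
    congr 1
    push_cast
    field_simp
    ring
  rw [e3]
  ring

theorem fourier_tdmLp (lam k : ℝ) (hl : lam ≠ 0) (f : Lp ℂ 2 (volume : Measure ℝ)) :
    𝓕 (tdmLp lam k 0 hl f) = tdmLp lam⁻¹ 0 (2 * Real.pi * k) (inv_ne_zero hl) (𝓕 f) := by
  have hd : DenseRange fun S : SchwartzMap ℝ ℂ => S.toLp 2 (volume : Measure ℝ) :=
    SchwartzMap.denseRange_toLpCLM (p := 2) (by norm_num)
  have hcont : Continuous fun f : Lp ℂ 2 (volume : Measure ℝ) => (𝓕 f : Lp ℂ 2 volume) :=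
    (Lp.fourierTransformₗᵢ ℝ ℂ).continuous
  refine hd.induction_on (p := fun f => 𝓕 (tdmLp lam k 0 hl f) =
    tdmLp lam⁻¹ 0 (2 * Real.pi * k) (inv_ne_zero hl) (𝓕 f)) f
    (isClosed_eq (hcont.comp (isometry_tdmLp lam k 0 hl).continuous)
      ((isometry_tdmLp _ _ _ (inv_ne_zero hl)).continuous.comp hcont)) fun S => ?_
  have e1 : tdmLp lam k 0 hl (S.toLp 2) = (tdmSchwartz lam k hl S).toLp 2 := by
    apply Lp.ext
    filter_upwards [coeFn_tdmLp lam k 0 hl (S.toLp 2), tdm_congr_ae (S.coeFn_toLp 2 volume) hl k 0,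
      (tdmSchwartz lam k hl S).coeFn_toLp 2 volume] with x h1 h2 h3
    rw [h1, h2, h3, tdmSchwartz_apply]
  rw [e1, SchwartzMap.toLp_fourier_eq, SchwartzMap.toLp_fourier_eq]
  apply Lp.ext
  filter_upwards [coeFn_tdmLp lam⁻¹ 0 (2 * Real.pi * k) (inv_ne_zero hl) ((𝓕 S).toLp 2),
    tdm_congr_ae ((𝓕 S).coeFn_toLp 2 volume) (inv_ne_zero hl) 0 (2 * Real.pi * k),
    (𝓕 (tdmSchwartz lam k hl S)).coeFn_toLp 2 volume] with x h1 h2 h3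
  rw [h1, h2, h3, fourier_tdmSchwartz]

/-! ### Plancherel's theorem -/

theorem two_pi_inv_ne_zero : (2 * Real.pi)⁻¹ ≠ 0 := inv_ne_zero Real.two_pi_pos.ne'

theorem fourierL2_eq (f : Lp ℂ 2 (volume : Measure ℝ)) :
    fourierL2 f = fun ξ => (𝓕 f : Lp ℂ 2 (volume : Measure ℝ)) ((2 * Real.pi)⁻¹ * ξ) := by
  ext ξ
  rw [fourierL2, div_eq_inv_mul]

theorem memLp_fourierL2 (f : Lp ℂ 2 (volume : Measure ℝ)) : MemLp (fourierL2 f) 2 := by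
  rw [fourierL2_eq]
  exact MemLp.comp_mul_left_real (Lp.memLp _) two_pi_inv_ne_zero

theorem eLpNorm_fourierL2_sq (f : Lp ℂ 2 (volume : Measure ℝ)) :
    eLpNorm (fourierL2 f) 2 volume ^ 2 =
      ENNReal.ofReal (2 * Real.pi) * eLpNorm f 2 volume ^ 2 := by
  have h : eLpNorm (𝓕 f : Lp ℂ 2 (volume : Measure ℝ)) 2 volume = eLpNorm f 2 volume := by
    rw [← Lp.enorm_def, ← Lp.enorm_def, ← ofReal_norm, ← ofReal_norm, Lp.norm_fourier_eq]
  rw [fourierL2_eq, eLpNorm_two_comp_mul_left_sq _ two_pi_inv_ne_zero, inv_inv,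
    abs_of_pos Real.two_pi_pos, h]

theorem pairFn_fourierL2 (f g : Lp ℂ 2 (volume : Measure ℝ)) :
    pairFn (fourierL2 f) (fourierL2 g) = 2 * Real.pi * pairFn f g := by
  have h1 : ∀ f g : Lp ℂ 2 (volume : Measure ℝ), pairFn f g = inner ℂ g f := fun f g => by
    rw [L2.inner_def, pairFn]
    simp only [RCLike.inner_apply]
  have h2 := Measure.integral_comp_mul_left (fun x => (𝓕 f : Lp ℂ 2 (volume : Measure ℝ)) x *
    conj ((𝓕 g : Lp ℂ 2 (volume : Measure ℝ)) x)) (2 * Real.pi)⁻¹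
  rw [fourierL2_eq, fourierL2_eq, h1, ← Lp.inner_fourier_eq, ← h1, pairFn, h2, inv_inv,
    abs_of_pos Real.two_pi_pos, Complex.real_smul, pairFn]
  push_cast
  rfl

theorem pairFn_congr_ae {f f' g g' : ℝ → ℂ} (hf : f =ᵐ[volume] f') (hg : g =ᵐ[volume] g') :
    pairFn f g = pairFn f' g' := by
  refine integral_congr_ae ?_
  filter_upwards [hf, hg] with x h1 h2
  rw [h1, h2]

theorem fourierL2_congr_ae (f : Lp ℂ 2 (volume : Measure ℝ)) {g : ℝ → ℂ}
    (h : (𝓕 f : Lp ℂ 2 (volume : Measure ℝ)) =ᵐ[volume] g) :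
    fourierL2 f =ᵐ[volume] fun ξ => g ((2 * Real.pi)⁻¹ * ξ) := by
  rw [fourierL2_eq]
  exact ae_comp_mul_left h two_pi_inv_ne_zero

/-- The rescaling in `fourierL2` absorbs the `2π` of the modulation, so time-domain systems
correspond to frequency-based ones with the same `k`. -/
theorem fourierL2_tdmLp (lam k : ℝ) (hl : lam ≠ 0) (f : Lp ℂ 2 (volume : Measure ℝ)) :
    fourierL2 (tdmLp lam k 0 hl f) =ᵐ[volume] tdm (fourierL2 f) lam⁻¹ 0 k := by
  have h1 := fourierL2_congr_ae (tdmLp lam k 0 hl f) (g := tdm (𝓕 f : Lp ℂ 2 (volume : Measure ℝ))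
    lam⁻¹ 0 (2 * Real.pi * k))
    (by rw [fourier_tdmLp]; exact coeFn_tdmLp _ _ _ _ _)
  filter_upwards [h1] with ξ hξ
  rw [hξ, fourierL2_eq, tdm, tdm]
  congr 2
  · congr 1
    push_cast
    field_simp
  · ring_nf

theorem pairFn_fourierL2_tdm (f g : Lp ℂ 2 (volume : Measure ℝ)) {lam : ℝ} (hl : lam ≠ 0)
    (k : ℝ) : pairFn (fourierL2 f) (tdm (fourierL2 g) lam⁻¹ 0 k) =
      2 * Real.pi * pairFn f (tdm g lam k 0) := by
  rw [← pairFn_congr_ae (ae_eq_refl _) (fourierL2_tdmLp lam k hl g), pairFn_fourierL2,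
    pairFn_congr_ae (ae_eq_refl _) (coeFn_tdmLp lam k 0 hl g)]

theorem exists_fourierL2_eq {f : ℝ → ℂ} (hf : MemLp f 2) :
    ∃ h : Lp ℂ 2 (volume : Measure ℝ), fourierL2 h =ᵐ[volume] f := by
  have h1 := MemLp.comp_mul_left_real hf Real.two_pi_pos.ne'
  refine ⟨𝓕⁻ h1.toLp, ?_⟩
  have h2 := fourierL2_congr_ae (𝓕⁻ h1.toLp) (g := fun x => f (2 * Real.pi * x)) (by
    rw [FourierTransform.fourier_fourierInv_eq]; exact h1.coeFn_toLp)
  filter_upwards [h2] with ξ hξ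
  rw [hξ]
  congr 1
  field_simp

section Energy

variable {d : ℝ} {J : ℤ} {r s : ℕ}

theorem freqEnergy_congr_ae (hd : d ≠ 0) {F F' : Fin r → ℝ → ℂ} {G G' : Fin s → ℝ → ℂ}
    {f f' : ℝ → ℂ} (hF : ∀ l, F l =ᵐ[volume] F' l) (hG : ∀ l, G l =ᵐ[volume] G' l)
    (hf : f =ᵐ[volume] f') : freqEnergy d J F G f = freqEnergy d J F' G' f' := by
  have h1 : ∀ (j : ℤ) l (k : ℝ), pairFn f (tdm (F l) (d ^ j) 0 k) =
      pairFn f' (tdm (F' l) (d ^ j) 0 k) := fun j l k =>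
    pairFn_congr_ae hf (tdm_congr_ae (hF l) (zpow_ne_zero j hd) 0 k)
  have h2 : ∀ (j : ℤ) l (k : ℝ), pairFn f (tdm (G l) (d ^ j) 0 k) =
      pairFn f' (tdm (G' l) (d ^ j) 0 k) := fun j l k =>
    pairFn_congr_ae hf (tdm_congr_ae (hG l) (zpow_ne_zero j hd) 0 k)
  simp only [freqEnergy, h1, h2]

theorem timeEnergy_congr_ae {F : Fin r → ℝ → ℂ} {G : Fin s → ℝ → ℂ}
    {f f' : ℝ → ℂ} (hf : f =ᵐ[volume] f') : timeEnergy d J F G f = timeEnergy d J F G f' := by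
  simp only [timeEnergy, fun g : ℝ → ℂ => pairFn_congr_ae hf (ae_eq_refl g)]

/-- Each coefficient gains a factor `2π`, hence the energy `(2π)²`, whereas the squared norm gains
only `2π`. This accounts for the frame constants `2π` in frequency and 1 in time. -/
theorem freqEnergy_fourierL2 (hd : d ≠ 0) (φ : Fin r → Lp ℂ 2 (volume : Measure ℝ))
    (ψ : Fin s → Lp ℂ 2 (volume : Measure ℝ)) (h : Lp ℂ 2 (volume : Measure ℝ)) :
    freqEnergy d J (fun l => fourierL2 (φ l)) (fun l => fourierL2 (ψ l)) (fourierL2 h) =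
      ENNReal.ofReal (2 * Real.pi) ^ 2 *
        timeEnergy d J (fun l => ⇑(φ l)) (fun l => ⇑(ψ l)) h := by
  have h1 : ∀ (g : Lp ℂ 2 (volume : Measure ℝ)) (j : ℤ) (k : ℝ),
      ‖pairFn (fourierL2 h) (tdm (fourierL2 g) (d ^ (-j)) 0 k)‖ₑ ^ 2 =
        ENNReal.ofReal (2 * Real.pi) ^ 2 * ‖pairFn h (tdm g (d ^ j) k 0)‖ₑ ^ 2 := by
    intro g j k
    rw [zpow_neg, pairFn_fourierL2_tdm h g (zpow_ne_zero j hd), enorm_mul, mul_pow,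
      show (2 * Real.pi : ℂ) = ((2 * Real.pi : ℝ) : ℂ) by push_cast; rfl, enorm_sq_eq_ofReal,
      Complex.norm_real, Real.norm_of_nonneg Real.two_pi_pos.le,
      ENNReal.ofReal_pow Real.two_pi_pos.le]
  simp only [freqEnergy, timeEnergy, h1, ENNReal.tsum_mul_left, ← Finset.mul_sum, mul_add]

theorem freqEnergy_fourierL2_eq_iff (hd : d ≠ 0) (φ : Fin r → Lp ℂ 2 (volume : Measure ℝ))
    (ψ : Fin s → Lp ℂ 2 (volume : Measure ℝ)) (h : Lp ℂ 2 (volume : Measure ℝ)) :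
    freqEnergy d J (fun l => fourierL2 (φ l)) (fun l => fourierL2 (ψ l)) (fourierL2 h) =
      ENNReal.ofReal (2 * Real.pi) * eLpNorm (fourierL2 h) 2 volume ^ 2 ↔
    timeEnergy d J (fun l => ⇑(φ l)) (fun l => ⇑(ψ l)) h = eLpNorm h 2 volume ^ 2 := by
  rw [freqEnergy_fourierL2 hd, eLpNorm_fourierL2_sq, ← mul_assoc, ← sq]
  refine ENNReal.mul_right_inj (pow_ne_zero _ ?_) (ENNReal.pow_ne_top ENNReal.ofReal_ne_top)
  exact (ENNReal.ofReal_pos.2 Real.two_pi_pos).ne'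

theorem isFourierOfTightFrame_iff (hd : d ≠ 0) {Φ : Fin r → Distr} {Ψ : Fin s → Distr} :
    IsFourierOfTightFrame d J Φ Ψ ↔ IsFreqTightFrame d J Φ Ψ := by
  constructor
  · rintro ⟨φ, ψ, hφ, hψ, hE⟩
    refine ⟨fun l => fourierL2 (φ l), fun l => fourierL2 (ψ l),
      fun l => ⟨memLp_fourierL2 _, hφ l⟩, fun l => ⟨memLp_fourierL2 _, hψ l⟩, fun f hf => ?_⟩
    obtain ⟨h, hh⟩ := exists_fourierL2_eq hf
    rw [← freqEnergy_congr_ae hd (fun l => ae_eq_refl _) (fun l => ae_eq_refl _) hh,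
      ← eLpNorm_congr_ae hh, freqEnergy_fourierL2_eq_iff hd]
    exact hE h (Lp.memLp h)
  · rintro ⟨F, G, hF, hG, hE⟩
    choose φ hφ using fun l => exists_fourierL2_eq (hF l).1
    choose ψ hψ using fun l => exists_fourierL2_eq (hG l).1
    refine ⟨φ, ψ, fun l => (hF l).2.congr (hφ l).symm, fun l => (hG l).2.congr (hψ l).symm,
      fun f hf => ?_⟩
    rw [← timeEnergy_congr_ae hf.coeFn_toLp, ← eLpNorm_congr_ae hf.coeFn_toLp,
      ← freqEnergy_fourierL2_eq_iff hd, freqEnergy_congr_ae hd hφ hψ (ae_eq_refl _)]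
    exact hE _ (memLp_fourierL2 _)

end Energy

end WaveletFrames

/-! ### The equivalences and the homogeneous frame. -/

theorem mainTheorem6 (d : ℝ) (hd : 1 < |d|) (r s : ℕ)
    (Φ : Fin r → Distr) (Ψ : Fin s → Distr) :
    [ ∃ J : ℤ, IsFreqTightFrame d J Φ Ψ,
      ∀ J : ℤ, IsFreqTightFrame d J Φ Ψ,
      ∃ J : ℤ, IsDualFramePair d J Φ Ψ Φ Ψ,
      ∀ J : ℤ, IsDualFramePair d J Φ Ψ Φ Ψ,
      SatisfiesCharConditions d Φ Ψ,
      ∃ J : ℤ, IsFourierOfTightFrame d J Φ Ψ,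
      ∀ J : ℤ, IsFourierOfTightFrame d J Φ Ψ ].TFAE ∧
    ((∃ J : ℤ, IsFreqTightFrame d J Φ Ψ) → IsFreqHomTightFrame d Ψ) := by
  have hd0 := ne_zero_of_one_lt_abs hd
  refine ⟨?_, fun ⟨J, hJ⟩ => hJ.isFreqHomTightFrame hd⟩
  simp only [isFourierOfTightFrame_iff hd0]
  tfae_have 1 → 3 := fun ⟨J, h⟩ => ⟨J, h.isDualFramePair hd0⟩
  -- The level is forgotten here and chosen freely in the next implication; this is where "some `J`"
  -- becomes "all `J`".
  tfae_have 3 → 5 := fun ⟨_, h⟩ => h.satisfiesCharConditions hd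
  tfae_have 5 → 4 := fun h J => h.isDualFramePair hd J
  tfae_have 4 → 2 := fun h J => (h J).isFreqTightFrame hd0
  tfae_have 2 → 1 := fun h => ⟨0, h 0⟩
  tfae_have 1 ↔ 6 := Iff.rfl
  tfae_have 2 ↔ 7 := Iff.rfl
  tfae_finish
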